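/- Let $K$ be a field of arbitrary characteristic, let $x=(x_1,\ldots,x_n)$ be variables, and let $H=(H_1,\ldots,H_m)\in K[x]^m$ be quadratic homogeneous, i.e. each $H_i$ is zero or homogeneous of degree $2$. Let ${\mathcal J}H=(\partial H_i/\partial x_j)_{i,j}$ be its $m\times n$ Jacobian matrix, and suppose that its rank $r:=\operatorname{rk}{\mathcal J}H$ over the field $K(x)$ satisfies $r\le 4$. Then there are $S\in\operatorname{GL}_m(K)$ and $T\in\operatorname{GL}_n(K)$ such that for $\tilde H:=S\,H(Tx)$, only the first $\frac12r^2+\frac12r$ rows of ${\mathcal J}\tilde H$ may be nonzero, and at least one of the following statements holds: 1. only the first $r+1$ rows of ${\mathcal J}\tilde H$ may be nonzero; 2. $r=4$, $\tilde H_i\in K[x_1,x_2,x_3]$ for all $i\ge2$, and $\operatorname{char}K\ne2$; 3. $r=4$, $\tilde H_i\in K[x_1,x_2,x_3,x_4,x_5^2,x_6^2,\ldots,x_n^2]$ for all $i\ge2$, and $\operatorname{char}K=2$; 4. only the first $r+1$ columns of ${\mathcal J}\tilde H$ may be nonzero; 5. $r=4$, $\operatorname{char}K=2$, and every nonzero entry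 of ${\mathcal J}\tilde H$ lies in its first $6$ rows and in its first $6$ columns. -/

import Mathlib

namespace QuadMap

open MvPolynomial

noncomputable section

/-- The Jacobian matrix `J H` of a polynomial map `H = (H_1, ..., H_m)` in `K[x_1, ..., x_n]^m`,
with entry `∂ H_i / ∂ x_j` in row `i` and column `j`. -/
def jacobian {K : Type*} [Field K] {m n : ℕ} (H : Fin m → MvPolynomial (Fin n) K) :
    Matrix (Fin m) (Fin n) (MvPolynomial (Fin n) K) :=
  Matrix.of fun i j => pderiv j (H i)

/-- The rank of the Jacobian matrix of `H`, over the field `K(x_1, ..., x_n)`. -/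
def jacobianRank {K : Type*} [Field K] {m n : ℕ} (H : Fin m → MvPolynomial (Fin n) K) : ℕ :=
  ((jacobian H).map
    (algebraMap (MvPolynomial (Fin n) K) (FractionRing (MvPolynomial (Fin n) K)))).rank

/-- The polynomial map `S H(T x)`: each variable `x_j` is replaced by the `j`-th coordinate
`∑ l, T_{j l} x_l` of `T x`, and the result is multiplied by `S` from the left. -/
def linComp {K : Type*} [Field K] {m n : ℕ} (S : Matrix (Fin m) (Fin m) K)
    (H : Fin m → MvPolynomial (Fin n) K) (T : Matrix (Fin n) (Fin n) K) :
    Fin m → MvPolynomial (Fin n) K :=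
  fun i => ∑ k, C (S i k) * aeval (fun j : Fin n => ∑ l, C (T j l) * X l) (H k)

/-- The subalgebra `K[x_1, ..., x_d, x_{d+1}^2, ..., x_n^2]` of `K[x_1, ..., x_n]`
(variables are indexed from `0` in the code). -/
def varsThenSquares (K : Type*) [Field K] (n d : ℕ) : Subalgebra K (MvPolynomial (Fin n) K) :=
  Algebra.adjoin K
    ({p | ∃ j : Fin n, j.val < d ∧ p = X j} ∪ {p | ∃ j : Fin n, d ≤ j.val ∧ p = X j ^ 2})

/-- Only the first `k` rows of the matrix `M` may be nonzero. -/
def OnlyFirstRows {R : Type*} [Zero R] {m n : ℕ} (M : Matrix (Fin m) (Fin n) R) (k : ℕ) : Prop :=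
  ∀ i j, k ≤ i.val → M i j = 0

/-- Only the first `k` columns of the matrix `M` may be nonzero. -/
def OnlyFirstCols {R : Type*} [Zero R] {m n : ℕ} (M : Matrix (Fin m) (Fin n) R) (k : ℕ) : Prop :=
  ∀ i j, k ≤ j.val → M i j = 0

end

end QuadMap

open Module Filter

section LinearFamilies

variable {F V E G : Type*} [Field F] [AddCommGroup V] [Module F V]
  [AddCommGroup E] [Module F E] [AddCommGroup G] [Module F G]

/-- A set `A` is open along lines if every line through a point of `A` leaves `A` at only finitely
many parameters. -/
def IsLineOpen (F : Type*) {V : Type*} [Field F] [AddCommGroup V] [Module F V] (A : Set V) : Prop :=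
  ∀ a ∈ A, ∀ x : V, {t : F | a + t • x ∉ A}.Finite

theorem IsLineOpen.inter {A A' : Set V} (h : IsLineOpen F A) (h' : IsLineOpen F A') :
    IsLineOpen F (A ∩ A') := by
  rintro a ⟨ha, ha'⟩ x
  refine ((h a ha x).union (h' a ha' x)).subset ?_
  intro t ht
  by_contra hc
  simp only [Set.mem_union, Set.mem_ofPred_eq, not_or, not_not] at hc
  exact ht hc

/-- The line through `a` and `b`, for `a ∈ A` and `b` arbitrary, meets `A` at almost all
parameters, with `b` as parameter `0`. -/
theorem IsLineOpen.finite_compl_through {A : Set V} (h : IsLineOpen F A) {a : V} (ha : a ∈ A)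
    (b : V) : {t : F | b + t • (a - b) ∉ A}.Finite := by
  have := (h a ha (b - a)).preimage (f := fun t : F => 1 - t) (by intro s _ t _ hst; simpa using hst)
  refine this.subset ?_
  intro t ht
  simp only [Set.mem_preimage, Set.mem_ofPred_eq] at ht ⊢
  convert ht using 2
  module

theorem IsLineOpen.nonempty_inter [Infinite F] {A A' : Set V} (h : IsLineOpen F A)
    (h' : IsLineOpen F A') (hA : A.Nonempty) (hA' : A'.Nonempty) : (A ∩ A').Nonempty := by
  obtain ⟨a, ha⟩ := hA
  obtain ⟨b, hb⟩ := hA'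
  obtain ⟨t, ht⟩ := ((h.finite_compl_through ha b).union (h' b hb (a - b))).exists_notMem
  simp only [Set.mem_union, Set.mem_ofPred_eq, not_or, not_not] at ht
  exact ⟨_, ht⟩

theorem isLineOpen_compl_submodule (P : Submodule F V) : IsLineOpen F (P : Set V)ᶜ := by
  intro a ha x
  refine Set.Subsingleton.finite ?_
  intro s hs t ht
  simp only [Set.mem_ofPred_eq, Set.mem_compl_iff, SetLike.mem_coe, not_not] at hs ht
  by_contra hst
  apply ha
  have h1 : (s - t) • x ∈ P := by
    have := P.sub_mem hs ht
    convert this using 1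
    module
  have h2 : x ∈ P := (P.smul_mem_iff (sub_ne_zero.2 hst)).1 h1
  have h3 := P.sub_mem hs (P.smul_mem s h2)
  simpa using h3

/-- The rank of a pencil of linear maps is at least the rank at parameter `0`, for almost all
parameters. -/
theorem finite_finrank_range_add_smul_lt [FiniteDimensional F G]
    (M N : E →ₗ[F] G) :
    {t : F | finrank F (LinearMap.range (M + t • N)) < finrank F (LinearMap.range M)}.Finite := by
  obtain ⟨P, hP⟩ := M.rangeRestrict.exists_rightInverse_of_surjective M.range_rangeRestrict
  obtain ⟨Q, hQ⟩ := (LinearMap.range M).subtype.exists_leftInverse_of_injective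
    (Submodule.ker_subtype _)
  have hP' : ∀ y, M (P y) = y := fun y => congrArg Subtype.val (LinearMap.congr_fun hP y)
  have hQ' : ∀ y : LinearMap.range M, Q y = y := fun y => LinearMap.congr_fun hQ y
  let R : End F (LinearMap.range M) := Q ∘ₗ N ∘ₗ P
  have hfin := (R.finite_hasEigenvalue).preimage (f := fun t : F => -t⁻¹)
    (by intro s _ t _ hst; simpa using hst)
  refine hfin.subset ?_
  intro t ht
  simp only [Set.mem_ofPred_eq] at ht
  have hA : ∀ y, (Q ∘ₗ (M + t • N) ∘ₗ P) y = y + t • R y := by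
    intro y
    simp [R, hP', hQ']
  have hninj : ¬ Function.Injective (Q ∘ₗ (M + t • N) ∘ₗ P) := by
    intro hinj
    have h1 := LinearMap.finrank_range_of_inj hinj
    have h2 : finrank F (LinearMap.range (Q ∘ₗ (M + t • N) ∘ₗ P)) ≤
        finrank F (LinearMap.range (M + t • N)) := by
      rw [LinearMap.range_comp]
      refine (Submodule.finrank_map_le _ _).trans (Submodule.finrank_mono ?_)
      exact LinearMap.range_comp_le_range _ _
    omega
  rw [← LinearMap.ker_eq_bot, Submodule.eq_bot_iff] at hninj
  push Not at hninj
  obtain ⟨y, hy, hy0⟩ := hninj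
  rw [LinearMap.mem_ker, hA] at hy
  have ht0 : t ≠ 0 := by
    rintro rfl
    simp at hy
    exact hy0 hy
  refine End.hasEigenvalue_of_hasEigenvector (x := y) ⟨End.mem_eigenspace_iff.2 ?_, hy0⟩
  have h3 : t • R y = - y := by
    rw [eq_neg_iff_add_eq_zero, add_comm]; exact hy
  have h4 : R y = t⁻¹ • (t • R y) := by rw [smul_smul, inv_mul_cancel₀ ht0, one_smul]
  rw [h4, h3]
  simp

theorem isLineOpen_le_finrank_range [FiniteDimensional F G] (L : V →ₗ[F] E →ₗ[F] G) (k : ℕ) :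
    IsLineOpen F {x | k ≤ finrank F (LinearMap.range (L x))} := by
  intro a ha x
  refine (finite_finrank_range_add_smul_lt (L a) (L x)).subset ?_
  intro t ht
  rw [Set.mem_ofPred_eq] at ht ha ⊢
  rw [Set.mem_ofPred_eq, not_le, map_add, map_smul] at ht
  omega

/-- The filter of sets containing a nonempty set that is open along lines. -/
def generic (F V : Type*) [Field F] [Infinite F] [AddCommGroup V] [Module F V] : Filter V where
  sets := {s | ∃ A ⊆ s, IsLineOpen F A ∧ A.Nonempty}
  univ_sets := ⟨Set.univ, subset_rfl, by intro a _ x; simp, ⟨0, trivial⟩⟩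
  sets_of_superset := by
    rintro s t ⟨A, hA, h⟩ hst
    exact ⟨A, hA.trans hst, h⟩
  inter_sets := by
    rintro s t ⟨A, hA, h, hn⟩ ⟨A', hA', h', hn'⟩
    exact ⟨A ∩ A', Set.inter_subset_inter hA hA', h.inter h', h.nonempty_inter h' hn hn'⟩

variable [Infinite F]

theorem IsLineOpen.eventually {A : Set V} (h : IsLineOpen F A) (hn : A.Nonempty) :
    ∀ᶠ x in generic F V, x ∈ A :=
  ⟨A, subset_rfl, h, hn⟩

instance generic_neBot : (generic F V).NeBot := by
  refine ⟨fun h => ?_⟩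
  obtain ⟨A, hA, -, a, ha⟩ : ∅ ∈ generic F V := by rw [h]; trivial
  exact hA ha

theorem mem_of_eventually_mem {P : Submodule F V} (h : ∀ᶠ x in generic F V, x ∈ P) (x : V) :
    x ∈ P := by
  by_contra hx
  have h2 := (isLineOpen_compl_submodule P).eventually ⟨x, hx⟩
  obtain ⟨y, hy, hy'⟩ := (h.and h2).exists
  exact hy' hy

theorem eventually_notMem {P : Submodule F V} {x : V} (hx : x ∉ P) :
    ∀ᶠ y in generic F V, y ∉ P :=
  (isLineOpen_compl_submodule P).eventually ⟨x, hx⟩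


theorem eventually_le_finrank_range [FiniteDimensional F G] (L : V →ₗ[F] E →ₗ[F] G) {x : V} {k : ℕ}
    (hx : k ≤ finrank F (LinearMap.range (L x))) :
    ∀ᶠ y in generic F V, k ≤ finrank F (LinearMap.range (L y)) :=
  (isLineOpen_le_finrank_range L k).eventually ⟨x, hx⟩

theorem finrank_range_le_of_eventually [FiniteDimensional F G] {L : V →ₗ[F] E →ₗ[F] G} {k : ℕ}
    (h : ∀ᶠ y in generic F V, finrank F (LinearMap.range (L y)) ≤ k) (x : V) :
    finrank F (LinearMap.range (L x)) ≤ k := by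
  by_contra hx
  obtain ⟨y, hy, hy'⟩ := (h.and (eventually_le_finrank_range L (Nat.lt_of_not_le hx))).exists
  omega

end LinearFamilies

section LinearFamily

variable {F V E G : Type*} [Field F] [AddCommGroup V] [Module F V] [AddCommGroup E]
  [Module F E] [AddCommGroup G] [Module F G]

/-- The restriction of a linear family of maps to the kernel of one of its members. -/
def restrictKer (L : V →ₗ[F] E →ₗ[F] G) (v : V) : V →ₗ[F] LinearMap.ker (L v) →ₗ[F] G :=
  L.compl₂ (LinearMap.ker (L v)).subtype

/-- A linear family of maps modulo the range of one of its members. -/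
def modRange (L : V →ₗ[F] E →ₗ[F] G) (v : V) : V →ₗ[F] E →ₗ[F] G ⧸ LinearMap.range (L v) :=
  L.compr₂ (LinearMap.range (L v)).mkQ

theorem modRange_apply (L : V →ₗ[F] E →ₗ[F] G) (v x : V) (y : E) :
    modRange L v x y = (LinearMap.range (L v)).mkQ (L x y) := rfl

theorem modRange_apply_eq_zero_iff {L : V →ₗ[F] E →ₗ[F] G} {v x : V} {y : E} :
    modRange L v x y = 0 ↔ L x y ∈ LinearMap.range (L v) := by
  rw [modRange_apply, Submodule.mkQ_apply, Submodule.Quotient.mk_eq_zero]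

theorem eq_zero_of_finrank_range_le_zero [FiniteDimensional F G] {L : V →ₗ[F] E →ₗ[F] G}
    (h : ∀ x, finrank F (LinearMap.range (L x)) ≤ 0) :
    L = 0 := by
  ext x y
  have := LinearMap.range_eq_bot.1 (Submodule.finrank_eq_zero.1 (Nat.le_zero.1 (h x)))
  simp [this]

theorem exists_forall_finrank_range_le [FiniteDimensional F G] (L : V →ₗ[F] E →ₗ[F] G) :
    ∃ v, ∀ x, finrank F (LinearMap.range (L x)) ≤ finrank F (LinearMap.range (L v)) := by
  have hb : BddAbove (Set.range fun x => finrank F (LinearMap.range (L x))) :=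
    ⟨finrank F G, by rintro _ ⟨x, rfl⟩; exact Submodule.finrank_le _⟩
  obtain ⟨v, hv⟩ := Nat.sSup_mem (Set.range_nonempty _) hb
  exact ⟨v, fun x => (le_csSup hb ⟨x, rfl⟩).trans_eq hv.symm⟩

end LinearFamily

section MaximalRank

variable {F V E G : Type*} [Field F] [Infinite F] [AddCommGroup V] [Module F V] [AddCommGroup E]
  [Module F E] [AddCommGroup G] [Module F G] [FiniteDimensional F E] [FiniteDimensional F G]
  {L : V →ₗ[F] E →ₗ[F] G} {r : ℕ} {v : V}

theorem mem_range_of_pencil (hle : ∀ x, finrank F (LinearMap.range (L x)) ≤ r)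
    (hv : finrank F (LinearMap.range (L v)) = r) (x : V) (z : G)
    (hz : {t : F | z ∉ LinearMap.range (L (v + t • x))}.Finite) :
    z ∈ LinearMap.range (L v) := by
  by_contra hzv
  let M : E × F →ₗ[F] G := (L v).coprod (LinearMap.toSpanSingleton F G z)
  let N : E × F →ₗ[F] G := (L x).coprod 0
  have hM : r + 1 ≤ finrank F (LinearMap.range M) := by
    rw [← hv]
    refine Submodule.finrank_lt_finrank_of_lt (lt_of_le_of_ne ?_ ?_)
    · rintro _ ⟨e, rfl⟩
      exact ⟨(e, 0), by simp [M]⟩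
    · intro h
      apply hzv
      rw [h]
      exact ⟨(0, 1), by simp [M]⟩
  obtain ⟨t, ht⟩ := (hz.union (finite_finrank_range_add_smul_lt M N)).exists_notMem
  simp only [Set.mem_union, Set.mem_ofPred_eq, not_or, not_not, not_lt] at ht
  have h2 : LinearMap.range (M + t • N) ≤ LinearMap.range (L (v + t • x)) := by
    rintro _ ⟨⟨e, s⟩, rfl⟩
    have : (M + t • N) (e, s) = L (v + t • x) e + s • z := by
      simp [M, N]
      abel
    rw [this]
    exact Submodule.add_mem _ ⟨e, rfl⟩ (Submodule.smul_mem _ _ ht.1)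
  have h3 := Submodule.finrank_mono h2
  have h4 := hle (v + t • x)
  omega

theorem apply_mem_range_of_mem_ker (hle : ∀ x, finrank F (LinearMap.range (L x)) ≤ r)
    (hv : finrank F (LinearMap.range (L v)) = r) (x : V) {u : E} (hu : L v u = 0) :
    L x u ∈ LinearMap.range (L v) := by
  refine mem_range_of_pencil hle hv x _ ((Set.finite_singleton (0 : F)).subset ?_)
  intro t ht
  by_contra h0
  refine ht ⟨t⁻¹ • u, ?_⟩
  simp [hu, smul_smul, inv_mul_cancel₀ (show t ≠ 0 from h0)]

theorem apply_mem_range_of_apply_eq (hle : ∀ x, finrank F (LinearMap.range (L x)) ≤ r)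
    (hv : finrank F (LinearMap.range (L v)) = r) (x : V) {u y : E} (hu : L v u = 0)
    (hy : L v y = L x u) : L x y ∈ LinearMap.range (L v) := by
  refine mem_range_of_pencil hle hv x _ ((Set.finite_singleton (0 : F)).subset ?_)
  intro t ht
  by_contra h0
  have h0 : t ≠ 0 := h0
  refine ht ⟨t⁻¹ • y - (t⁻¹ * t⁻¹) • u, ?_⟩
  simp only [map_add, map_smul, map_sub, LinearMap.add_apply, LinearMap.smul_apply, hu, hy]
  simp only [smul_add, smul_smul, smul_zero]
  field_simp
  simp

theorem comap_map_le_ker_modRange (hle : ∀ x, finrank F (LinearMap.range (L x)) ≤ r)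
    (hv : finrank F (LinearMap.range (L v)) = r) (x : V) :
    ((LinearMap.ker (L v)).map (L x)).comap (L v) ≤ LinearMap.ker (modRange L v x) := by
  rintro y ⟨u, hu, huy⟩
  rw [LinearMap.mem_ker, modRange_apply_eq_zero_iff]
  exact apply_mem_range_of_apply_eq hle hv x hu huy.symm

theorem finrank_comap_map_ker (hle : ∀ x, finrank F (LinearMap.range (L x)) ≤ r)
    (hv : finrank F (LinearMap.range (L v)) = r) (x : V) :
    finrank F (((LinearMap.ker (L v)).map (L x)).comap (L v)) =
      finrank F (LinearMap.ker (L v)) + finrank F (LinearMap.range (restrictKer L v x)) := by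
  set Y := ((LinearMap.ker (L v)).map (L x)).comap (L v) with hY
  have h1 := LinearMap.finrank_range_add_finrank_ker ((L v).domRestrict Y)
  have h2 : LinearMap.range (restrictKer L v x) = (LinearMap.ker (L v)).map (L x) := by
    ext z
    simp [restrictKer]
  have h3 : LinearMap.range ((L v).domRestrict Y) = (LinearMap.ker (L v)).map (L x) := by
    rw [LinearMap.range_domRestrict, hY, Submodule.map_comap_eq, inf_eq_right]
    rintro _ ⟨u, hu, rfl⟩
    exact apply_mem_range_of_mem_ker hle hv x hu
  have h4 : finrank F (LinearMap.ker ((L v).domRestrict Y)) = finrank F (LinearMap.ker (L v)) := by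
    rw [LinearMap.ker_domRestrict]
    have hUY : LinearMap.ker (L v) ≤ Y := by
      intro u hu
      rw [hY, Submodule.mem_comap, LinearMap.mem_ker.1 hu]
      exact Submodule.zero_mem _
    exact (Submodule.comapSubtypeEquivOfLe hUY).finrank_eq
  rw [h3, h4] at h1
  rw [h2]
  omega

theorem finrank_restrictKer_add_finrank_modRange_le
    (hle : ∀ x, finrank F (LinearMap.range (L x)) ≤ r)
    (hv : finrank F (LinearMap.range (L v)) = r) (x : V) :
    finrank F (LinearMap.range (restrictKer L v x)) +
      finrank F (LinearMap.range (modRange L v x)) ≤ r := by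
  have h1 := Submodule.finrank_mono (comap_map_le_ker_modRange hle hv x)
  have h2 := finrank_comap_map_ker hle hv x
  have h3 := LinearMap.finrank_range_add_finrank_ker (L v)
  have h4 := LinearMap.finrank_range_add_finrank_ker (modRange L v x)
  omega

theorem add_le_of_le_finrank_of_le_finrank (hle : ∀ x, finrank F (LinearMap.range (L x)) ≤ r)
    (hv : finrank F (LinearMap.range (L v)) = r) {x y : V} {b c : ℕ}
    (hb : b ≤ finrank F (LinearMap.range (restrictKer L v x)))
    (hc : c ≤ finrank F (LinearMap.range (modRange L v y))) : b + c ≤ r := by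
  obtain ⟨z, hz, hz'⟩ := ((eventually_le_finrank_range (restrictKer L v) hb).and
    (eventually_le_finrank_range (modRange L v) hc)).exists
  have := finrank_restrictKer_add_finrank_modRange_le hle hv z
  omega

theorem apply_mem_map_ker_of_modRange_eq_zero (hle : ∀ x, finrank F (LinearMap.range (L x)) ≤ r)
    (hv : finrank F (LinearMap.range (L v)) = r) {x : V}
    (hx : r ≤ finrank F (LinearMap.range (restrictKer L v x)) +
      finrank F (LinearMap.range (modRange L v x))) {y : E} (hy : modRange L v x y = 0) :
    L v y ∈ (LinearMap.ker (L v)).map (L x) := by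
  have h1 := comap_map_le_ker_modRange hle hv x
  have h2 := finrank_comap_map_ker hle hv x
  have h3 := LinearMap.finrank_range_add_finrank_ker (L v)
  have h4 := LinearMap.finrank_range_add_finrank_ker (modRange L v x)
  have h5 := Submodule.eq_of_le_of_finrank_le h1 (by omega)
  have h6 : y ∈ LinearMap.ker (modRange L v x) := hy
  rwa [← h5] at h6

/-- A linear space of maps of rank at most one has a common image line or a common kernel
hyperplane. -/
theorem common_line_or_common_kernel (h : ∀ x, finrank F (LinearMap.range (L x)) ≤ 1) :
    (∃ w : G, ∀ x e, L x e ∈ F ∙ w) ∨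
      ∃ X : Submodule F E, finrank F E ≤ finrank F X + 1 ∧ ∀ x, ∀ e ∈ X, L x e = 0 := by
  by_cases h0 : ∀ x, finrank F (LinearMap.range (L x)) ≤ 0
  · left
    refine ⟨0, fun x e => ?_⟩
    rw [eq_zero_of_finrank_range_le_zero h0]
    simp
  push Not at h0
  obtain ⟨v, hv⟩ := h0
  have hv : finrank F (LinearMap.range (L v)) = 1 := le_antisymm (h v) hv
  by_cases hb : ∀ x, finrank F (LinearMap.range (restrictKer L v x)) ≤ 0
  · right
    refine ⟨LinearMap.ker (L v), ?_, fun x e he => ?_⟩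
    · have := LinearMap.finrank_range_add_finrank_ker (L v)
      omega
    · exact LinearMap.congr_fun (LinearMap.congr_fun (eq_zero_of_finrank_range_le_zero hb) x) ⟨e, he⟩
  · left
    push Not at hb
    obtain ⟨x, hx⟩ := hb
    have hc : ∀ y, finrank F (LinearMap.range (modRange L v y)) ≤ 0 := by
      intro y
      have := add_le_of_le_finrank_of_le_finrank h hv (x := x) (y := y) hx le_rfl
      omega
    obtain ⟨w, hw⟩ := (finrank_le_one_iff (K := F) (V := LinearMap.range (L v))).1 hv.le
    refine ⟨w, fun x e => ?_⟩
    have h1 : modRange L v x e = 0 := by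
      rw [eq_zero_of_finrank_range_le_zero hc]
      rfl
    rw [modRange_apply_eq_zero_iff] at h1
    obtain ⟨c, hc⟩ := hw ⟨_, h1⟩
    exact Submodule.mem_span_singleton.2 ⟨c, congrArg Subtype.val hc⟩

theorem eventually_apply_mem_range (hle : ∀ x, finrank F (LinearMap.range (L x)) ≤ r)
    (hv : finrank F (LinearMap.range (L v)) = r) {x y : V} {b c : ℕ}
    (hb : b ≤ finrank F (LinearMap.range (restrictKer L v x)))
    (hc : c ≤ finrank F (LinearMap.range (modRange L v y))) (hbc : r ≤ b + c) {q : E}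
    (hq : ∀ z, L z q ∈ LinearMap.range (L v)) :
    ∀ᶠ z in generic F V, L v q ∈ LinearMap.range (L z) := by
  filter_upwards [eventually_le_finrank_range (restrictKer L v) hb,
    eventually_le_finrank_range (modRange L v) hc] with z hz hz'
  exact LinearMap.map_le_range
    (apply_mem_map_ker_of_modRange_eq_zero hle hv (by omega) (modRange_apply_eq_zero_iff.2 (hq z)))

theorem finrank_range_modLine_le (hle : ∀ x, finrank F (LinearMap.range (L x)) ≤ r + 1)
    {w : G} (hw : w ≠ 0) (h : ∀ᶠ x in generic F V, w ∈ LinearMap.range (L x)) (x : V) :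
    finrank F (LinearMap.range (L.compr₂ (F ∙ w).mkQ x)) ≤ r := by
  refine finrank_range_le_of_eventually (h.mono fun y hy => ?_) x
  have h1 : LinearMap.range (L.compr₂ (F ∙ w).mkQ y) = (LinearMap.range (L y)).map (F ∙ w).mkQ := by
    rw [← LinearMap.range_comp]
    rfl
  have h2 := LinearMap.finrank_range_add_finrank_ker
    ((F ∙ w).mkQ.domRestrict (LinearMap.range (L y)))
  rw [LinearMap.range_domRestrict, ← h1] at h2
  have h3 : 0 < finrank F (LinearMap.ker ((F ∙ w).mkQ.domRestrict (LinearMap.range (L y)))) := by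
    rw [finrank_pos_iff]
    refine ⟨⟨⟨w, hy⟩, ?_⟩, 0, fun h0 => hw ?_⟩
    · simp
    · simpa using congrArg (fun z => z.1.1) h0
  have h4 := hle y
  omega

end MaximalRank

section ValueSpan

variable {F V W : Type*} [Field F] [AddCommGroup V] [Module F V] [AddCommGroup W] [Module F W]

/-- The span of the values of a bilinear map. -/
def valueSpan (B : V →ₗ[F] V →ₗ[F] W) : Submodule F W :=
  Submodule.map₂ B ⊤ ⊤

theorem apply_mem_valueSpan (B : V →ₗ[F] V →ₗ[F] W) (x y : V) : B x y ∈ valueSpan B :=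
  Submodule.apply_mem_map₂ _ trivial trivial

theorem valueSpan_le {B : V →ₗ[F] V →ₗ[F] W} {P : Submodule F W} :
    valueSpan B ≤ P ↔ ∀ x y, B x y ∈ P := by
  simp [valueSpan, Submodule.map₂_le]

/-- The bilinear maps that occur as polar form of a quadratic map: symmetric, and alternating in
characteristic two. -/
structure IsPolar (B : V →ₗ[F] V →ₗ[F] W) : Prop where
  symm : ∀ x y, B x y = B y x
  alt : (2 : F) = 0 → ∀ x, B x x = 0

theorem IsPolar.compr₂ {W' : Type*} [AddCommGroup W'] [Module F W'] {B : V →ₗ[F] V →ₗ[F] W}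
    (hB : IsPolar B) (f : W →ₗ[F] W') : IsPolar (B.compr₂ f) where
  symm x y := by simp [hB.symm x y]
  alt h x := by simp [hB.alt h x]

variable [FiniteDimensional F V] [FiniteDimensional F W]

omit [FiniteDimensional F V] in
theorem finrank_valueSpan_le_add_compr₂ (B : V →ₗ[F] V →ₗ[F] W) (I : Submodule F W) :
    finrank F (valueSpan B) ≤ finrank F I + finrank F (valueSpan (B.compr₂ I.mkQ)) := by
  have h2 := LinearMap.finrank_range_add_finrank_ker (I.mkQ.domRestrict (valueSpan B))
  have h1 : LinearMap.range (I.mkQ.domRestrict (valueSpan B)) ≤ valueSpan (B.compr₂ I.mkQ) := by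
    rw [LinearMap.range_domRestrict, Submodule.map_le_iff_le_comap, valueSpan_le]
    intro x y
    exact apply_mem_valueSpan (B.compr₂ I.mkQ) x y
  have h3 : finrank F (LinearMap.ker (I.mkQ.domRestrict (valueSpan B))) ≤ finrank F I := by
    rw [LinearMap.ker_domRestrict, Submodule.ker_mkQ]
    rw [← LinearMap.finrank_range_of_inj (f := (valueSpan B).subtype.domRestrict
      (I.comap (valueSpan B).subtype)) fun a b h => Subtype.ext (Subtype.ext h)]
    refine Submodule.finrank_mono ?_
    rintro _ ⟨z, rfl⟩
    exact z.2
  have := Submodule.finrank_mono h1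
  omega

omit [FiniteDimensional F W] in
theorem exists_range_span_of_radical {B : V →ₗ[F] V →ₗ[F] W} (hs : ∀ x y, B x y = B y x)
    {R : Submodule F V} (hR : ∀ x ∈ R, ∀ y, B x y = 0) {k : ℕ}
    (hk : finrank F V ≤ finrank F R + k) :
    ∃ (l : ℕ) (e : Fin l → V), l ≤ k ∧
      valueSpan B ≤ Submodule.span F (Set.range fun p : Fin l × Fin l => B (e p.1) (e p.2)) := by
  obtain ⟨C, hC⟩ := R.exists_isCompl
  have hdim := Submodule.finrank_add_eq_of_isCompl hC
  let b := finBasis F C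
  refine ⟨finrank F C, fun i => b i, by omega, ?_⟩
  have hspan : C = Submodule.span F (Set.range fun i => (b i : V)) := by
    have := congrArg (Submodule.map C.subtype) b.span_eq
    rw [Submodule.map_span, ← Set.range_comp, Submodule.map_top, Submodule.range_subtype] at this
    exact this.symm
  rw [valueSpan_le]
  intro x y
  obtain ⟨x1, hx1, x2, hx2, rfl⟩ := Submodule.mem_sup.1 (hC.sup_eq_top ▸ Submodule.mem_top (x := x))
  obtain ⟨y1, hy1, y2, hy2, rfl⟩ := Submodule.mem_sup.1 (hC.sup_eq_top ▸ Submodule.mem_top (x := y))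
  have h1 : B (x1 + x2) (y1 + y2) = B x2 y2 := by
    simp only [map_add, LinearMap.add_apply, hR x1 hx1, hs x2 y1, hR y1 hy1, zero_add]
  rw [h1]
  have h2 := Submodule.apply_mem_map₂ B hx2 hy2
  rw [hspan, Submodule.map₂_span_span] at h2
  refine Submodule.span_mono ?_ h2
  rintro _ ⟨_, ⟨i, rfl⟩, _, ⟨j, rfl⟩, rfl⟩
  exact ⟨(i, j), rfl⟩

theorem finrank_valueSpan_le_of_symm {B : V →ₗ[F] V →ₗ[F] W} (hs : ∀ x y, B x y = B y x)
    {R : Submodule F V} (hR : ∀ x ∈ R, ∀ y, B x y = 0) {k : ℕ}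
    (hk : finrank F V ≤ finrank F R + k) :
    finrank F (valueSpan B) ≤ (k + 1).choose 2 := by
  obtain ⟨l, e, hl, h⟩ := exists_range_span_of_radical hs hR hk
  let f : Sym2 (Fin l) → W := Sym2.lift ⟨fun i j => B (e i) (e j), fun i j => hs _ _⟩
  have h1 : valueSpan B ≤ Submodule.span F (Set.range f) := by
    refine h.trans (Submodule.span_mono ?_)
    rintro _ ⟨p, rfl⟩
    exact ⟨s(p.1, p.2), rfl⟩
  refine ((Submodule.finrank_mono h1).trans (finrank_range_le_card f)).trans ?_
  rw [Sym2.card, Fintype.card_fin]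
  exact Nat.choose_le_choose 2 (by omega)

theorem finrank_valueSpan_le_of_alt {B : V →ₗ[F] V →ₗ[F] W} (hs : ∀ x y, B x y = B y x)
    (ha : ∀ x, B x x = 0) {R : Submodule F V} (hR : ∀ x ∈ R, ∀ y, B x y = 0) {k : ℕ}
    (hk : finrank F V ≤ finrank F R + k) :
    finrank F (valueSpan B) ≤ k.choose 2 := by
  obtain ⟨l, e, hl, h⟩ := exists_range_span_of_radical hs hR hk
  let f : Sym2 (Fin l) → W := Sym2.lift ⟨fun i j => B (e i) (e j), fun i j => hs _ _⟩
  have h1 : valueSpan B ≤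
      Submodule.span F (Set.range fun z : {z : Sym2 (Fin l) // ¬ z.IsDiag} => f z) := by
    refine h.trans (Submodule.span_le.2 ?_)
    rintro _ ⟨⟨i, j⟩, rfl⟩
    by_cases hij : i = j
    · subst hij
      simp [ha]
    · exact Submodule.subset_span ⟨⟨s(i, j), by simpa using hij⟩, rfl⟩
  refine ((Submodule.finrank_mono h1).trans (finrank_range_le_card _)).trans ?_
  rw [Sym2.card_subtype_not_diag, Fintype.card_fin]
  exact Nat.choose_le_choose 2 (by omega)

end ValueSpan

section PolarRank

variable {F V W : Type*} [Field F] [Infinite F] [AddCommGroup V] [Module F V] [AddCommGroup W]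
  [Module F W] {B : V →ₗ[F] V →ₗ[F] W}

theorem IsPolar.eq_zero_of_eventually (hB : IsPolar B) (h2 : (2 : F) ≠ 0)
    (h : ∀ᶠ x in generic F V, B x x = 0) : B = 0 := by
  obtain ⟨A, hA, hopen, a, ha⟩ := h
  have hxx : ∀ x, B x x = 0 := by
    intro x
    have hf := (hopen a ha x).union (Set.finite_singleton (0 : F))
    obtain ⟨s, hs⟩ := hf.exists_notMem
    obtain ⟨t, ht⟩ := (hf.union (Set.finite_singleton s)).exists_notMem
    simp only [Set.mem_union, Set.mem_ofPred_eq, Set.mem_singleton_iff, not_or, not_not] at hs ht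
    have key : ∀ t : F, t ≠ 0 → a + t • x ∈ A → (2 : F) • B a x + t • B x x = 0 := by
      intro t ht0 ht
      have h1 : B (a + t • x) (a + t • x) = 0 := hA ht
      have h3 : B a a = 0 := hA ha
      simp only [map_add, map_smul, LinearMap.add_apply, LinearMap.smul_apply, h3, hB.symm x a] at h1
      have h4 : t • ((2 : F) • B a x + t • B x x) = 0 := by
        rw [← h1]
        module
      exact (smul_eq_zero.1 h4).resolve_left ht0
    have h5 := key s hs.2 hs.1
    have h6 := key t ht.1.2 ht.1.1
    have h7 : (t - s) • B x x = 0 := by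
      have : (t - s) • B x x = ((2 : F) • B a x + t • B x x) - ((2 : F) • B a x + s • B x x) := by
        module
      rw [this, h5, h6, sub_zero]
    exact (smul_eq_zero.1 h7).resolve_left (sub_ne_zero.2 ht.2)
  ext x y
  have h1 := hxx (x + y)
  simp only [map_add, LinearMap.add_apply, hxx, hB.symm y x, zero_add, add_zero] at h1
  rw [← two_smul F] at h1
  exact (smul_eq_zero.1 h1).resolve_left h2

variable [FiniteDimensional F V] [FiniteDimensional F W] {r : ℕ} {v : V}

theorem IsPolar.apply_mem_range_of_mem_ker (hB : IsPolar B)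
    (hle : ∀ x, finrank F (LinearMap.range (B x)) ≤ r)
    (hv : finrank F (LinearMap.range (B v)) = r) {u : V} (hu : B v u = 0) (x : V) :
    B u x ∈ LinearMap.range (B v) := by
  rw [hB.symm]
  exact _root_.apply_mem_range_of_mem_ker hle hv x hu

omit [FiniteDimensional F V] in
theorem IsPolar.exists_regular (hB : IsPolar B) (h2 : (2 : F) ≠ 0) (hB0 : B ≠ 0) :
    ∃ v, (∀ x, finrank F (LinearMap.range (B x)) ≤ finrank F (LinearMap.range (B v))) ∧
      B v v ≠ 0 := by
  obtain ⟨v, hv⟩ := exists_forall_finrank_range_le B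
  have h1 : ∃ᶠ x in generic F V, B x x ≠ 0 := fun h =>
    hB0 (hB.eq_zero_of_eventually h2 (h.mono fun x hx => not_not.1 hx))
  obtain ⟨w, hw, hw'⟩ := (h1.and_eventually (eventually_le_finrank_range B le_rfl)).exists
  exact ⟨w, fun x => (hv x).trans hw', hw⟩

omit [FiniteDimensional F V] in
theorem IsPolar.exists_isMax (hB : IsPolar B) (hB0 : B ≠ 0) :
    ∃ v, (∀ x, finrank F (LinearMap.range (B x)) ≤ finrank F (LinearMap.range (B v))) ∧
      ((2 : F) ≠ 0 → B v v ≠ 0) := by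
  by_cases h2 : (2 : F) = 0
  · obtain ⟨v, hv⟩ := exists_forall_finrank_range_le B
    exact ⟨v, hv, fun h => absurd h2 h⟩
  · obtain ⟨v, hv, h⟩ := hB.exists_regular h2 hB0
    exact ⟨v, hv, fun _ => h⟩

theorem IsPolar.finrank_valueSpan_le (hB : IsPolar B)
    (hle : ∀ x, finrank F (LinearMap.range (B x)) ≤ r) :
    finrank F (valueSpan B) ≤ (r + 1).choose 2 := by
  by_cases hB0 : B = 0
  · subst hB0
    have : valueSpan (0 : V →ₗ[F] V →ₗ[F] W) = ⊥ := by
      rw [eq_bot_iff, valueSpan_le]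
      simp
    rw [this, finrank_bot]
    exact Nat.zero_le _
  obtain ⟨v, hv, hvv⟩ := hB.exists_isMax hB0
  have hs := finrank_valueSpan_le_add_compr₂ B (LinearMap.range (B v))
  have hpol := hB.compr₂ (LinearMap.range (B v)).mkQ
  have hrk := LinearMap.finrank_range_add_finrank_ker (B v)
  have hker : ∀ u ∈ LinearMap.ker (B v), ∀ y, B.compr₂ (LinearMap.range (B v)).mkQ u y = 0 :=
    fun u hu y => modRange_apply_eq_zero_iff.2 (hB.apply_mem_range_of_mem_ker hv rfl hu y)
  have hfin : finrank F (valueSpan (B.compr₂ (LinearMap.range (B v)).mkQ)) ≤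
      (finrank F (LinearMap.range (B v))).choose 2 := by
    by_cases h2 : (2 : F) = 0
    · exact finrank_valueSpan_le_of_alt hpol.symm (hpol.alt h2) hker (by omega)
    · have hv0 : v ∉ LinearMap.ker (B v) := hvv h2
      have hlt : LinearMap.ker (B v) < LinearMap.ker (B v) ⊔ F ∙ v := by
        refine lt_of_le_of_ne le_sup_left fun h => hv0 ?_
        rw [h]
        exact Submodule.mem_sup_right (Submodule.mem_span_singleton_self v)
      have hd := Submodule.finrank_lt_finrank_of_lt hlt
      have hpos : 0 < finrank F (LinearMap.range (B v)) := by
        rw [finrank_pos_iff]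
        exact ⟨⟨B v v, v, rfl⟩, 0, fun h => hvv h2 (congrArg Subtype.val h)⟩
      obtain ⟨k, hk⟩ := Nat.exists_eq_add_of_lt hpos
      rw [zero_add] at hk
      rw [hk]
      refine finrank_valueSpan_le_of_symm (R := LinearMap.ker (B v) ⊔ F ∙ v) hpol.symm ?_ (by omega)
      intro x hx y
      obtain ⟨u, hu, z, hz, rfl⟩ := Submodule.mem_sup.1 hx
      obtain ⟨c, rfl⟩ := Submodule.mem_span_singleton.1 hz
      rw [map_add, LinearMap.add_apply, hker u hu, map_smul, LinearMap.smul_apply, zero_add]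
      have : B.compr₂ (LinearMap.range (B v)).mkQ v y = 0 := modRange_apply_eq_zero_iff.2 ⟨y, rfl⟩
      rw [this, smul_zero]
  have h3 : (finrank F (LinearMap.range (B v)) + 1).choose 2 ≤ (r + 1).choose 2 :=
    Nat.choose_le_choose 2 (by have := hle v; omega)
  rw [Nat.choose_succ_succ' _ 1, Nat.choose_one_right, one_add_one_eq_two] at h3
  omega

/-- If the family modulo the range of a regular member has rank at most `k`, then the values of `B`
span a space of dimension at most `r + k (k + 1) / 2`. -/
theorem IsPolar.finrank_valueSpan_le_add (hB : IsPolar B)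
    (hv : finrank F (LinearMap.range (B v)) = r) {k : ℕ}
    (hk : ∀ x, finrank F (LinearMap.range (modRange B v x)) ≤ k) :
    finrank F (valueSpan B) ≤ r + (k + 1).choose 2 := by
  have h1 := finrank_valueSpan_le_add_compr₂ B (LinearMap.range (B v))
  have h2 := (hB.compr₂ (LinearMap.range (B v)).mkQ).finrank_valueSpan_le hk
  omega

end PolarRank

section Classification

variable {F V W : Type*} [Field F] [Infinite F] [AddCommGroup V] [Module F V] [AddCommGroup W]
  [Module F W] [FiniteDimensional F W]

theorem eventually_mem_range_of_forall_mem_line {E : Type*} [AddCommGroup E] [Module F E]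
    {L : V →ₗ[F] E →ₗ[F] W} {w : W} (h : ∀ x e, L x e ∈ F ∙ w) {x : V}
    (hx : 1 ≤ finrank F (LinearMap.range (L x))) :
    w ≠ 0 ∧ ∀ᶠ y in generic F V, w ∈ LinearMap.range (L y) := by
  have key : ∀ y, 1 ≤ finrank F (LinearMap.range (L y)) → w ≠ 0 ∧ w ∈ LinearMap.range (L y) := by
    intro y hy
    have hne : LinearMap.range (L y) ≠ ⊥ := by
      intro h0
      rw [h0, finrank_bot] at hy
      omega
    obtain ⟨_, ⟨e, rfl⟩, he⟩ := Submodule.exists_mem_ne_zero_of_ne_bot hne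
    obtain ⟨c, hc⟩ := Submodule.mem_span_singleton.1 (h y e)
    have hc0 : c ≠ 0 := by
      rintro rfl
      exact he (by rw [← hc, zero_smul])
    refine ⟨?_, c⁻¹ • e, ?_⟩
    · rintro rfl
      exact he (by rw [← hc, smul_zero])
    · rw [map_smul, ← hc, smul_smul, inv_mul_cancel₀ hc0, one_smul]
  exact ⟨(key x hx).1, (eventually_le_finrank_range L hx).mono fun y hy => (key y hy).2⟩

omit [Infinite F] [FiniteDimensional F W] in
theorem range_restrictKer_le {E : Type*} [AddCommGroup E] [Module F E]
    (L : V →ₗ[F] E →ₗ[F] W) (v x : V) :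
    LinearMap.range (restrictKer L v x) ≤ LinearMap.range (L x) := by
  rintro _ ⟨u, rfl⟩
  exact ⟨u, rfl⟩

variable [FiniteDimensional F V] {B : V →ₗ[F] V →ₗ[F] W} {v : V} {r : ℕ}

omit [Infinite F] [FiniteDimensional F V] in
theorem IsPolar.ker_eq_radical (hB : IsPolar B)
    (hb : ∀ x, finrank F (LinearMap.range (restrictKer B v x)) ≤ 0) {u : V}
    (hu : u ∈ LinearMap.ker (B v)) (x : V) : B u x = 0 := by
  rw [hB.symm]
  exact LinearMap.congr_fun (LinearMap.congr_fun (eq_zero_of_finrank_range_le_zero hb) x) ⟨u, hu⟩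

/-- If a line `F ∙ w` lies in the range of almost all `B x`, which have rank at most `r + 1`, then
the values of `B` span at most one dimension more than the bound for rank `r`. -/
theorem IsPolar.finrank_valueSpan_le_of_line (hB : IsPolar B)
    (hle : ∀ x, finrank F (LinearMap.range (B x)) ≤ r + 1) {w : W} (hw : w ≠ 0)
    (h : ∀ᶠ x in generic F V, w ∈ LinearMap.range (B x)) :
    finrank F (valueSpan B) ≤ (r + 1).choose 2 + 1 := by
  have h1 := finrank_valueSpan_le_add_compr₂ B (F ∙ w)
  rw [finrank_span_singleton hw] at h1
  have h2 := (hB.compr₂ (F ∙ w).mkQ).finrank_valueSpan_le (finrank_range_modLine_le hle hw h)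
  omega

/-- For a polar form of rank three, the values span at most a four-dimensional space, or the form
has a radical of codimension at most three (four in characteristic two). -/
theorem IsPolar.rank_three (hB : IsPolar B)
    (hle : ∀ x, finrank F (LinearMap.range (B x)) ≤ 3) :
    finrank F (valueSpan B) ≤ 4 ∨ ∃ X : Submodule F V,
      (finrank F V ≤ finrank F X + 3 ∨ ((2 : F) = 0 ∧ finrank F V ≤ finrank F X + 4)) ∧
      ∀ x ∈ X, ∀ y, B x y = 0 := by
  by_cases hB0 : B = 0
  · right
    refine ⟨⊤, Or.inl (by rw [finrank_top]; omega), fun x _ y => by simp [hB0]⟩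
  obtain ⟨v, hv, hvv⟩ := hB.exists_isMax hB0
  by_cases hr : finrank F (LinearMap.range (B v)) ≤ 2
  · left
    exact (hB.finrank_valueSpan_le fun x => (hv x).trans hr).trans (by decide)
  have hr : finrank F (LinearMap.range (B v)) = 3 := le_antisymm (hle v) (by omega)
  by_cases hc : ∀ x, finrank F (LinearMap.range (modRange B v x)) ≤ 1
  · left
    exact hB.finrank_valueSpan_le_add hr hc
  push Not at hc
  obtain ⟨y, hy⟩ := hc
  have hb : ∀ x, finrank F (LinearMap.range (restrictKer B v x)) ≤ 1 := by
    intro x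
    have := add_le_of_le_finrank_of_le_finrank hle hr (x := x) (y := y) le_rfl hy
    omega
  have hdim := LinearMap.finrank_range_add_finrank_ker (B v)
  by_cases hb0 : ∀ x, finrank F (LinearMap.range (restrictKer B v x)) ≤ 0
  · right
    exact ⟨LinearMap.ker (B v), Or.inl (by omega), fun u hu x => hB.ker_eq_radical hb0 hu x⟩
  push Not at hb0
  obtain ⟨x, hx⟩ := hb0
  by_cases h2 : (2 : F) = 0
  · rcases common_line_or_common_kernel hb with ⟨w, hw⟩ | ⟨X, hX, hX0⟩
    · left
      obtain ⟨hw0, hwe⟩ := eventually_mem_range_of_forall_mem_line hw hx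
      exact hB.finrank_valueSpan_le_of_line hle hw0
        (hwe.mono fun z hz => range_restrictKer_le B v z hz)
    · right
      refine ⟨X.map (LinearMap.ker (B v)).subtype, Or.inr ⟨h2, ?_⟩, ?_⟩
      · rw [Submodule.finrank_map_subtype_eq]
        omega
      · rintro _ ⟨u, hu, rfl⟩ y
        rw [hB.symm]
        exact hX0 y u hu
  · left
    exact hB.finrank_valueSpan_le_of_line hle (hvv h2)
      (eventually_apply_mem_range hle hr hx hy (by norm_num) fun z => ⟨z, hB.symm v z⟩)

theorem IsPolar.rank_four_of_line (hB : IsPolar B)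
    (hle : ∀ x, finrank F (LinearMap.range (B x)) ≤ 4) {w : W} (hw : w ≠ 0)
    (h : ∀ᶠ x in generic F V, w ∈ LinearMap.range (B x)) :
    finrank F (valueSpan B) ≤ 5 ∨ ∃ w : W, w ≠ 0 ∧ ∃ X : Submodule F V,
      (finrank F V ≤ finrank F X + 3 ∨ ((2 : F) = 0 ∧ finrank F V ≤ finrank F X + 4)) ∧
      ∀ x ∈ X, ∀ y, B x y ∈ F ∙ w := by
  rcases (hB.compr₂ (F ∙ w).mkQ).rank_three (finrank_range_modLine_le hle hw h) with h1 | h1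
  · left
    have h2 := finrank_valueSpan_le_add_compr₂ B (F ∙ w)
    rw [finrank_span_singleton hw] at h2
    omega
  · right
    obtain ⟨X, hX, hX0⟩ := h1
    refine ⟨w, hw, X, hX, fun x hx y => ?_⟩
    have := hX0 x hx y
    rwa [LinearMap.compr₂_apply, Submodule.mkQ_apply, Submodule.Quotient.mk_eq_zero] at this

/-- An alternating form of rank two has values spanning a line or a plane, or a radical of
codimension at most three. -/
theorem IsPolar.rank_two_of_two_eq_zero (hB : IsPolar B) (h2 : (2 : F) = 0)
    (hle : ∀ x, finrank F (LinearMap.range (B x)) ≤ 2) :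
    finrank F (valueSpan B) ≤ 2 ∨ ∃ X : Submodule F V,
      finrank F V ≤ finrank F X + 3 ∧ ∀ x ∈ X, ∀ y, B x y = 0 := by
  obtain ⟨v, hv⟩ := exists_forall_finrank_range_le B
  by_cases hr : finrank F (LinearMap.range (B v)) ≤ 1
  · left
    exact (hB.finrank_valueSpan_le fun x => (hv x).trans hr).trans (by decide)
  have hr : finrank F (LinearMap.range (B v)) = 2 := le_antisymm (hle v) (by omega)
  by_cases hc : ∀ x, finrank F (LinearMap.range (modRange B v x)) ≤ 0
  · left
    exact hB.finrank_valueSpan_le_add hr hc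
  push Not at hc
  obtain ⟨y, hy⟩ := hc
  have hb : ∀ x, finrank F (LinearMap.range (restrictKer B v x)) ≤ 1 := by
    intro x
    have := add_le_of_le_finrank_of_le_finrank hle hr (x := x) (y := y) le_rfl hy
    omega
  have hdim := LinearMap.finrank_range_add_finrank_ker (B v)
  rcases common_line_or_common_kernel hb with ⟨w, hw⟩ | ⟨X, hX, hX0⟩
  · exfalso
    have h1 : LinearMap.range (B v) ≤ F ∙ w := by
      rintro _ ⟨x, rfl⟩
      rw [hB.symm]
      exact hw x ⟨v, hB.alt h2 v⟩
    have h3 := (Submodule.finrank_mono h1).trans (finrank_span_le_card {w})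
    simp at h3
    omega
  · right
    refine ⟨X.map (LinearMap.ker (B v)).subtype, ?_, ?_⟩
    · rw [Submodule.finrank_map_subtype_eq]
      omega
    · rintro _ ⟨u, hu, rfl⟩ y
      rw [hB.symm]
      exact hX0 y u hu

/-- In characteristic two, the restriction to the kernel of a regular member of rank four has a
common kernel of codimension two if its rank is two, unless there is a common line. -/
theorem IsPolar.restrictKer_rank_two (hB : IsPolar B) (h2 : (2 : F) = 0)
    (hr : finrank F (LinearMap.range (B v)) = 4)
    (hb : ∀ x, finrank F (LinearMap.range (restrictKer B v x)) ≤ 2) :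
    (∃ w ≠ 0, ∀ᶠ x in generic F V, w ∈ LinearMap.range (B x)) ∨
      ∃ X : Submodule F V, finrank F V ≤ finrank F X + 6 ∧ ∀ x ∈ X, ∀ y, B x y = 0 := by
  set L := restrictKer B v with hL
  have hdim := LinearMap.finrank_range_add_finrank_ker (B v)
  obtain ⟨a, ha⟩ := exists_forall_finrank_range_le L
  have hdima := LinearMap.finrank_range_add_finrank_ker (L a)
  by_cases hb0 : ∀ x, finrank F (LinearMap.range (restrictKer L a x)) ≤ 0
  · right
    refine ⟨(LinearMap.ker (L a)).map (LinearMap.ker (B v)).subtype, ?_, ?_⟩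
    · rw [Submodule.finrank_map_subtype_eq]
      have := hb a
      omega
    · rintro _ ⟨u, hu, rfl⟩ y
      rw [hB.symm]
      exact LinearMap.congr_fun (LinearMap.congr_fun (eq_zero_of_finrank_range_le_zero hb0) y)
        ⟨u, hu⟩
  push Not at hb0
  obtain ⟨x, hx⟩ := hb0
  left
  let v' : LinearMap.ker (B v) := ⟨v, hB.alt h2 v⟩
  have hc : ∀ y, finrank F (LinearMap.range (modRange L a y)) ≤ 1 := by
    intro y
    have := add_le_of_le_finrank_of_le_finrank ha rfl (x := x) (y := y) hx le_rfl
    have := hb a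
    omega
  have hnot : ∀ P : Submodule F W, finrank F P ≤ 3 → ∃ y, B y v ∉ P := by
    intro P hP
    by_contra! hcon
    have h1 : LinearMap.range (B v) ≤ P := by
      rintro _ ⟨y, rfl⟩
      rw [hB.symm]
      exact hcon y
    have := Submodule.finrank_mono h1
    omega
  rcases common_line_or_common_kernel hc with ⟨w, hw⟩ | ⟨X, hX, hX0⟩
  · exfalso
    obtain ⟨z, rfl⟩ := Submodule.mkQ_surjective _ w
    obtain ⟨y, hy⟩ := hnot (LinearMap.range (L a) ⊔ F ∙ z) (by
      have h1 := Submodule.finrank_add_le_finrank_add_finrank (LinearMap.range (L a)) (F ∙ z)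
      have h3 := finrank_span_le_card (R := F) {z}
      simp only [Set.toFinset_singleton, Finset.card_singleton] at h3
      have := hb a
      omega)
    obtain ⟨c, hc⟩ := Submodule.mem_span_singleton.1 (hw y v')
    rw [← map_smul, eq_comm, modRange_apply, ← sub_eq_zero, ← map_sub, Submodule.mkQ_apply,
      Submodule.Quotient.mk_eq_zero] at hc
    apply hy
    have h3 : B y v = (L y v' - c • z) + c • z := by
      rw [sub_add_cancel]
      rfl
    rw [h3]
    exact Submodule.add_mem_sup hc (Submodule.smul_mem _ _ (Submodule.mem_span_singleton_self z))
  · have hv'X : v' ∉ X := by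
      intro hmem
      obtain ⟨y, hy⟩ := hnot (LinearMap.range (L a)) ((hb a).trans (by norm_num))
      exact hy (modRange_apply_eq_zero_iff.1 (hX0 y v' hmem))
    have hsup : X ⊔ F ∙ v' = ⊤ := by
      apply Submodule.eq_top_of_finrank_eq
      have hlt : X < X ⊔ F ∙ v' := by
        refine lt_of_le_of_ne le_sup_left fun h => hv'X ?_
        rw [h]
        exact Submodule.mem_sup_right (Submodule.mem_span_singleton_self _)
      have h1 := Submodule.finrank_lt_finrank_of_lt hlt
      have h3 := Submodule.finrank_le (X ⊔ F ∙ v')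
      omega
    have hcoef : ∀ (c : F) (z : V), L z v' ∉ LinearMap.range (L a) → ∀ y ∈ X,
        L z (y + c • v') ∈ LinearMap.range (L a) → c = 0 := by
      intro c z hz y hy hmem
      by_contra hc0
      rw [map_add, map_smul] at hmem
      have h1 := (Submodule.add_mem_iff_right _ (modRange_apply_eq_zero_iff.1 (hX0 z y hy))).1 hmem
      exact hz ((Submodule.smul_mem_iff _ hc0).1 h1)
    have hdecomp : ∀ u, ∃ y ∈ X, ∃ c : F, u = y + c • v' := by
      intro u
      obtain ⟨y, hy, w, hw, rfl⟩ := Submodule.mem_sup.1 (hsup ▸ Submodule.mem_top (x := u))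
      obtain ⟨c, rfl⟩ := Submodule.mem_span_singleton.1 hw
      exact ⟨y, hy, c, rfl⟩
    obtain ⟨z, hz⟩ := hnot (LinearMap.range (L a)) ((hb a).trans (by norm_num))
    have hkerX : LinearMap.ker (L a) ≤ X := by
      intro u hu
      obtain ⟨y, hy, c, rfl⟩ := hdecomp u
      have := hcoef c z hz y hy (_root_.apply_mem_range_of_mem_ker ha rfl z hu)
      simpa [this] using hy
    have hP : finrank F (X.map (L a)) ≤ 1 := by
      have h1 := LinearMap.finrank_range_add_finrank_ker ((L a).domRestrict X)
      rw [LinearMap.range_domRestrict, LinearMap.ker_domRestrict,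
        (Submodule.comapSubtypeEquivOfLe hkerX).finrank_eq] at h1
      have h3 := Submodule.finrank_lt (s := X) fun h => hv'X (h ▸ Submodule.mem_top)
      have := hb a
      omega
    have hmem : ∀ u ∈ LinearMap.ker (L a), ∀ z, L z u ∈ X.map (L a) := by
      intro u hu
      refine mem_of_eventually_mem (P := (X.map (L a)).comap (L.flip u)) ?_
      filter_upwards [eventually_notMem (P := (LinearMap.range (L a)).comap (L.flip v')) (x := z) hz]
        with z hz
      obtain ⟨y, hy⟩ := _root_.apply_mem_range_of_mem_ker ha rfl z hu
      have h1 := apply_mem_range_of_apply_eq ha rfl z hu hy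
      obtain ⟨y, hyX, c, rfl⟩ := hdecomp y
      obtain rfl := hcoef c z hz y hyX h1
      refine ⟨y, hyX, ?_⟩
      rw [LinearMap.flip_apply, ← hy, zero_smul, add_zero]
    obtain ⟨w, hw⟩ := (finrank_le_one_iff (K := F) (V := X.map (L a))).1 hP
    have hline : ∀ z u, restrictKer L a z u ∈ F ∙ (w : W) := by
      intro z u
      obtain ⟨c, hc⟩ := hw ⟨_, hmem u u.2 z⟩
      exact Submodule.mem_span_singleton.2 ⟨c, congrArg Subtype.val hc⟩
    obtain ⟨hw0, hwe⟩ := eventually_mem_range_of_forall_mem_line hline hx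
    exact ⟨w, hw0, hwe.mono fun z hz =>
      range_restrictKer_le B v z (range_restrictKer_le L a z hz)⟩

/-- Classification of polar forms of rank `r ≤ 4` over an infinite field. -/
theorem IsPolar.classification (hB : IsPolar B) (hr4 : r ≤ 4)
    (hle : ∀ x, finrank F (LinearMap.range (B x)) ≤ r)
    (hv : finrank F (LinearMap.range (B v)) = r) :
    finrank F (valueSpan B) ≤ r + 1 ∨
    (r = 4 ∧ ∃ w : W, w ≠ 0 ∧ ∃ X : Submodule F V,
      (finrank F V ≤ finrank F X + 3 ∨ ((2 : F) = 0 ∧ finrank F V ≤ finrank F X + 4)) ∧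
      ∀ x ∈ X, ∀ y, B x y ∈ F ∙ w) ∨
    (∃ X : Submodule F V, finrank F V ≤ finrank F X + (r + 1) ∧ ∀ x ∈ X, ∀ y, B x y = 0) ∨
    (r = 4 ∧ (2 : F) = 0 ∧ finrank F (valueSpan B) ≤ 6 ∧
      ∃ X : Submodule F V, finrank F V ≤ finrank F X + 6 ∧ ∀ x ∈ X, ∀ y, B x y = 0) := by
  by_cases hB0 : B = 0
  · right; right; left
    exact ⟨⊤, by rw [finrank_top]; omega, fun x _ y => by simp [hB0]⟩
  obtain ⟨v, hv', hvv⟩ : ∃ v, finrank F (LinearMap.range (B v)) = r ∧ ((2 : F) ≠ 0 → B v v ≠ 0) := by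
    obtain ⟨v', h1, h2⟩ := hB.exists_isMax hB0
    exact ⟨v', le_antisymm (hle v') (hv ▸ h1 v), h2⟩
  clear hv
  by_cases hc : ∀ x, finrank F (LinearMap.range (modRange B v x)) ≤ 1
  · left
    exact hB.finrank_valueSpan_le_add hv' hc
  push Not at hc
  obtain ⟨y, hy⟩ := hc
  have hb : ∀ x, finrank F (LinearMap.range (restrictKer B v x)) ≤ r - 2 := by
    intro x
    have := add_le_of_le_finrank_of_le_finrank hle hv' (x := x) (y := y) le_rfl hy
    omega
  have hdim := LinearMap.finrank_range_add_finrank_ker (B v)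
  by_cases hb0 : ∀ x, finrank F (LinearMap.range (restrictKer B v x)) ≤ 0
  · right; right; left
    exact ⟨LinearMap.ker (B v), by omega, fun u hu x => hB.ker_eq_radical hb0 hu x⟩
  push Not at hb0
  obtain ⟨x, hx⟩ := hb0
  have hr3 : r = 3 ∨ r = 4 := by have := hb x; omega
  have hline : ∀ w : W, w ≠ 0 → (∀ᶠ x in generic F V, w ∈ LinearMap.range (B x)) →
      finrank F (valueSpan B) ≤ r + 1 ∨
      (r = 4 ∧ ∃ w : W, w ≠ 0 ∧ ∃ X : Submodule F V,
        (finrank F V ≤ finrank F X + 3 ∨ ((2 : F) = 0 ∧ finrank F V ≤ finrank F X + 4)) ∧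
        ∀ x ∈ X, ∀ y, B x y ∈ F ∙ w) := by
    intro w hw hwe
    rcases hr3 with rfl | rfl
    · left
      exact hB.finrank_valueSpan_le_of_line hle hw hwe
    · rcases hB.rank_four_of_line hle hw hwe with h | h
      · exact Or.inl h
      · exact Or.inr ⟨rfl, h⟩
  have hfin {C : Prop} (w : W) (hw : w ≠ 0)
      (hwe : ∀ᶠ x in generic F V, w ∈ LinearMap.range (B x)) :=
    (hline w hw hwe).imp_right (Or.inl (b := C))
  by_cases hb1 : ∀ x, finrank F (LinearMap.range (restrictKer B v x)) ≤ 1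
  · rcases common_line_or_common_kernel hb1 with ⟨w, hw⟩ | ⟨X, hX, hX0⟩
    · obtain ⟨hw0, hwe⟩ := eventually_mem_range_of_forall_mem_line hw hx
      exact hfin w hw0 (hwe.mono fun z hz => range_restrictKer_le B v z hz)
    · right; right; left
      refine ⟨X.map (LinearMap.ker (B v)).subtype, ?_, ?_⟩
      · rw [Submodule.finrank_map_subtype_eq]
        omega
      · rintro _ ⟨u, hu, rfl⟩ y
        rw [hB.symm]
        exact hX0 y u hu
  push Not at hb1
  obtain ⟨x, hx⟩ := hb1
  obtain rfl : r = 4 := by have := hb x; omega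
  by_cases h2 : (2 : F) = 0
  swap
  · exact hfin _ (hvv h2)
      (eventually_apply_mem_range hle hv' hx hy (by norm_num) fun z => ⟨z, hB.symm v z⟩)
  by_cases hq : ∃ q, q ∉ LinearMap.ker (B v) ∧ ∀ z, B z q ∈ LinearMap.range (B v)
  · obtain ⟨q, hq, hq'⟩ := hq
    exact hfin _ hq (eventually_apply_mem_range hle hv' hx hy (by norm_num) hq')
  push Not at hq
  have hc2 : ∀ x, finrank F (LinearMap.range (modRange B v x)) ≤ 2 := by
    intro y
    have := add_le_of_le_finrank_of_le_finrank hle hv' (x := x) (y := y) hx le_rfl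
    omega
  have hspan : finrank F (valueSpan B) ≤ 6 := by
    have h1 := finrank_valueSpan_le_add_compr₂ B (LinearMap.range (B v))
    have hpol := hB.compr₂ (LinearMap.range (B v)).mkQ
    rcases hpol.rank_two_of_two_eq_zero h2 hc2 with h3 | ⟨X, hX, hX0⟩
    · omega
    · exfalso
      have h3 : X ≤ LinearMap.ker (B v) := by
        intro q hqX
        by_contra hqv
        obtain ⟨z, hz⟩ := hq q hqv
        apply hz
        have h4 : modRange B v q z = 0 := hX0 q hqX z
        rw [hB.symm]
        exact modRange_apply_eq_zero_iff.1 h4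
      have := Submodule.finrank_mono h3
      omega
  rcases hB.restrictKer_rank_two h2 hv' hb with ⟨w, hw, hwe⟩ | hX
  · exact hfin w hw hwe
  · exact Or.inr (Or.inr (Or.inr ⟨rfl, h2, hspan, hX⟩))

end Classification

section Minors

open Matrix

variable {m n : Type*} [Fintype m] [Fintype n]

theorem exists_linearIndependent_cols {F : Type*} [Field F] (A : Matrix m n F) :
    ∃ g : Fin A.rank → n, LinearIndependent F (A.submatrix id g).col := by
  rw [A.rank_eq_finrank_span_cols]
  obtain ⟨f, hf, -, hli⟩ := Submodule.exists_fun_fin_finrank_span_eq F (Set.range A.col)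
  choose g hg using hf
  refine ⟨g, ?_⟩
  rwa [show (A.submatrix id g).col = f from funext fun i => hg i]

theorem exists_det_submatrix_ne_zero {F : Type*} [Field F] (A : Matrix m n F) :
    ∃ (f : Fin A.rank → m) (g : Fin A.rank → n), (A.submatrix f g).det ≠ 0 := by
  obtain ⟨g, hg⟩ := exists_linearIndependent_cols A
  have hrank : ((A.submatrix id g)ᵀ).rank = A.rank := by
    have := LinearIndependent.rank_matrix (M := (A.submatrix id g)ᵀ) hg
    rwa [Fintype.card_fin] at this
  obtain ⟨f, hf⟩ := exists_linearIndependent_cols (A.submatrix id g)ᵀ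
  refine ⟨f ∘ Fin.cast hrank.symm, g, ?_⟩
  have h1 : LinearIndependent F (A.submatrix (f ∘ Fin.cast hrank.symm) g).row :=
    hf.comp _ (Fin.cast_injective _)
  rw [Matrix.linearIndependent_rows_iff_isUnit, Matrix.isUnit_iff_isUnit_det] at h1
  exact h1.ne_zero

omit [Fintype m] in
theorem le_rank_of_det_submatrix_ne_zero {F : Type*} [Field F] {A : Matrix m n F} {k : ℕ}
    {f : Fin k → m} {g : Fin k → n} (h : (A.submatrix f g).det ≠ 0) : k ≤ A.rank := by
  have h1 := Matrix.rank_of_det_ne_zero h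
  have h2 := A.rank_submatrix_le f g
  rw [h1, Fintype.card_fin] at h2
  exact h2

theorem rank_map_le_rank_map {R F L : Type*} [CommRing R] [Field F] [Field L] (A : Matrix m n R)
    (f : R →+* F) (g : R →+* L) (hg : Function.Injective g) :
    (A.map f).rank ≤ (A.map g).rank := by
  obtain ⟨s, t, h⟩ := exists_det_submatrix_ne_zero (A.map f)
  refine le_rank_of_det_submatrix_ne_zero (f := s) (g := t) ?_
  have key : ∀ {F : Type _} [Field F] (f : R →+* F),
      ((A.map f).submatrix s t).det = f (A.submatrix s t).det := by
    intro F _ f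
    rw [RingHom.map_det]
    rfl
  have h1 : ((A.map g).submatrix s t).det = g (A.submatrix s t).det := by
    rw [RingHom.map_det]
    rfl
  rw [key] at h
  rw [h1]
  intro h0
  rw [map_eq_zero_iff g hg] at h0
  rw [h0, map_zero] at h
  exact h rfl

theorem rank_map_ringHom_eq {F L : Type*} [Field F] [Field L] (A : Matrix m n F) (f : F →+* L) :
    (A.map f).rank = A.rank := by
  have h1 := rank_map_le_rank_map A f (RingHom.id F) Function.injective_id
  have h2 := rank_map_le_rank_map A (RingHom.id F) f f.injective
  have h3 : A.map (RingHom.id F) = A := by ext; rfl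
  rw [h3] at h1 h2
  exact le_antisymm h1 h2

/-- A matrix over `F[x_1, ..., x_n]` attains its rank at some point over an infinite extension. -/
theorem exists_rank_le_rank_eval {F L ι : Type*} [Field F] [Field L] [Infinite L]
    (f : F →+* L) (A : Matrix m n (MvPolynomial ι F)) :
    ∃ x : ι → L, (A.map (algebraMap _ (FractionRing (MvPolynomial ι F)))).rank ≤
      (A.map (MvPolynomial.eval₂Hom f x)).rank := by
  obtain ⟨s, t, h⟩ := exists_det_submatrix_ne_zero
    (A.map (algebraMap _ (FractionRing (MvPolynomial ι F))))
  have h0 : (A.submatrix s t).det ≠ 0 := by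
    intro h0
    apply h
    have h1 := RingHom.map_det (algebraMap _ (FractionRing (MvPolynomial ι F))) (A.submatrix s t)
    rw [h0, map_zero] at h1
    exact h1.symm
  have h1 : MvPolynomial.map f (A.submatrix s t).det ≠ 0 := by
    rwa [Ne, map_eq_zero_iff _ (MvPolynomial.map_injective f f.injective)]
  obtain ⟨x, hx⟩ : ∃ x, MvPolynomial.eval x (MvPolynomial.map f (A.submatrix s t).det) ≠ 0 := by
    by_contra! hcon
    exact h1 (MvPolynomial.funext fun x => by rw [hcon x, map_zero])
  refine ⟨x, le_rank_of_det_submatrix_ne_zero (f := s) (g := t) ?_⟩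
  rw [MvPolynomial.eval_map] at hx
  have h2 := RingHom.map_det (MvPolynomial.eval₂Hom f x) (A.submatrix s t)
  rw [MvPolynomial.coe_eval₂Hom] at h2
  rw [h2] at hx
  exact hx

omit [Fintype m] in
theorem exists_codim_iff_rank_le {F : Type*} [Field F] (A : Matrix m n F) (k : ℕ) :
    (∃ X : Submodule F (n → F), finrank F (n → F) ≤ finrank F X + k ∧ ∀ x ∈ X, A *ᵥ x = 0) ↔
      A.rank ≤ k := by
  have h1 := LinearMap.finrank_range_add_finrank_ker A.mulVecLin
  change A.rank + _ = _ at h1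
  constructor
  · rintro ⟨X, hX, h⟩
    have h2 : X ≤ LinearMap.ker A.mulVecLin := h
    have := Submodule.finrank_mono h2
    omega
  · intro h
    exact ⟨LinearMap.ker A.mulVecLin, by omega, fun x hx => hx⟩

end Minors

section Tensor

open Matrix

variable {m n : ℕ}

/-- The bilinear map with components `∑ j k, a i j k x_k y_j`. -/
def tensorForm {F : Type*} [Field F] (a : Fin m → Fin n → Fin n → F) :
    (Fin n → F) →ₗ[F] (Fin n → F) →ₗ[F] (Fin m → F) :=
  LinearMap.mk₂ F (fun x y i => ∑ j, (∑ k, a i j k * x k) * y j)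
    (by intros; ext; simp [mul_add, add_mul, Finset.sum_add_distrib])
    (by intros; ext; simp [Finset.mul_sum, Finset.sum_mul, mul_assoc, mul_left_comm])
    (by intros; ext; simp [mul_add, Finset.sum_add_distrib])
    (by intros; ext; simp [Finset.mul_sum, mul_left_comm])

theorem tensorForm_apply {F : Type*} [Field F] (a : Fin m → Fin n → Fin n → F) (x y : Fin n → F)
    (i : Fin m) : tensorForm a x y i = ∑ j, (∑ k, a i j k * x k) * y j := rfl

theorem tensorForm_eq_mulVecLin {F : Type*} [Field F] (a : Fin m → Fin n → Fin n → F)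
    (x : Fin n → F) :
    tensorForm a x = (Matrix.of fun i j => ∑ k, a i j k * x k).mulVecLin := rfl

theorem tensorForm_single {F : Type*} [Field F] (a : Fin m → Fin n → Fin n → F) (x : Fin n → F)
    (k : Fin n) (i : Fin m) : tensorForm a x (Pi.single k 1) i = ∑ l, a i k l * x l := by
  simp [tensorForm_apply, Pi.single_apply]

theorem isPolar_tensorForm {F : Type*} [Field F] {a : Fin m → Fin n → Fin n → F}
    (hs : ∀ i j k, a i j k = a i k j) (ha : (2 : F) = 0 → ∀ i j, a i j j = 0) :
    IsPolar (tensorForm a) where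
  symm x y := by
    ext i
    simp only [tensorForm_apply, Finset.sum_mul]
    rw [Finset.sum_comm]
    refine Finset.sum_congr rfl fun j _ => Finset.sum_congr rfl fun k _ => ?_
    rw [hs i k j]
    ring
  alt h2 x := by
    ext i
    simp only [tensorForm_apply, Finset.sum_mul, Pi.zero_apply]
    rw [← Finset.sum_product' Finset.univ Finset.univ fun j k => a i j k * x k * x j]
    refine Finset.sum_involution (fun p _ => (p.2, p.1)) ?_ ?_ ?_ ?_
    · rintro ⟨j, k⟩ -
      rw [hs i k j]
      linear_combination (a i j k * x k * x j) * h2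
    · rintro ⟨j, k⟩ - h heq
      obtain rfl : k = j := (Prod.ext_iff.1 heq).1
      simp [ha h2] at h
    · simp
    · simp

/-- The matrix whose columns are the values of the bilinear map on pairs of basis vectors. -/
def valueMatrix {R : Type*} (a : Fin m → Fin n → Fin n → R) : Matrix (Fin m) (Fin n × Fin n) R :=
  Matrix.of fun i p => a i p.1 p.2

/-- The matrix whose kernel is the radical of the bilinear map. -/
def radicalMatrix {R : Type*} (a : Fin m → Fin n → Fin n → R) : Matrix (Fin m × Fin n) (Fin n) R :=
  Matrix.of fun p j => a p.1 p.2 j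

/-- The matrix whose kernel is the radical of the bilinear map modulo the line spanned by `w`. -/
def lineMatrix {R : Type*} [CommRing R] (a : Fin m → Fin n → Fin n → R) (w : Fin m → R) :
    Matrix ((Fin m × Fin m) × Fin n) (Fin n) R :=
  Matrix.of fun p j => w p.1.1 * a p.1.2 p.2 j - w p.1.2 * a p.1.1 p.2 j

theorem finrank_valueSpan_tensorForm {F : Type*} [Field F] (a : Fin m → Fin n → Fin n → F) :
    finrank F (valueSpan (tensorForm a)) = (valueMatrix a).rank := by
  rw [Matrix.rank_eq_finrank_span_cols]
  suffices h : valueSpan (tensorForm a) = Submodule.span F (Set.range (valueMatrix a).col) by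
    rw [h]
  apply le_antisymm
  · rw [valueSpan_le]
    intro x y
    have : tensorForm a x y = ∑ j, ∑ k, (x k * y j) • (valueMatrix a).col (j, k) := by
      ext i
      simp only [tensorForm_apply, Finset.sum_mul, Finset.sum_apply, Pi.smul_apply, smul_eq_mul]
      refine Finset.sum_congr rfl fun j _ => Finset.sum_congr rfl fun k _ => ?_
      simp [valueMatrix]
      ring
    rw [this]
    exact Submodule.sum_mem _ fun j _ => Submodule.sum_mem _ fun k _ =>
      Submodule.smul_mem _ _ (Submodule.subset_span ⟨(j, k), rfl⟩)
  · rw [Submodule.span_le]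
    rintro _ ⟨⟨j, k⟩, rfl⟩
    have : (valueMatrix a).col (j, k) = tensorForm a (Pi.single k 1) (Pi.single j 1) := by
      ext i
      rw [tensorForm_single]
      simp [valueMatrix, Pi.single_apply]
    rw [this]
    exact apply_mem_valueSpan _ _ _

theorem radicalMatrix_mulVec_eq_zero_iff {F : Type*} [Field F] {a : Fin m → Fin n → Fin n → F}
    {x : Fin n → F} : radicalMatrix a *ᵥ x = 0 ↔ ∀ y, tensorForm a x y = 0 := by
  constructor
  · intro h y
    have : tensorForm a x = 0 := by
      refine LinearMap.pi_ext' fun k => LinearMap.ext_ring ?_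
      ext i
      exact (tensorForm_single a x k i).trans (congrFun h (i, k))
    rw [this]
    rfl
  · intro h
    ext ⟨i, k⟩
    exact (tensorForm_single a x k i).symm.trans (congrFun (h _) i)

theorem mem_span_singleton_iff_forall {F : Type*} [Field F] {w : Fin m → F} (hw : w ≠ 0)
    {z : Fin m → F} : z ∈ F ∙ w ↔ ∀ i i', w i * z i' - w i' * z i = 0 := by
  constructor
  · intro h i i'
    obtain ⟨c, rfl⟩ := Submodule.mem_span_singleton.1 h
    simp only [Pi.smul_apply, smul_eq_mul]
    ring
  · intro h
    obtain ⟨i, hi⟩ := Function.ne_iff.1 hw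
    refine Submodule.mem_span_singleton.2 ⟨z i / w i, ?_⟩
    ext i'
    have hi : w i ≠ 0 := hi
    have := h i i'
    simp only [Pi.smul_apply, smul_eq_mul]
    field_simp
    linear_combination -this

theorem lineMatrix_mulVec_eq_zero_iff {F : Type*} [Field F] {a : Fin m → Fin n → Fin n → F}
    {w : Fin m → F} (hw : w ≠ 0) {x : Fin n → F} :
    lineMatrix a w *ᵥ x = 0 ↔ ∀ y, tensorForm a x y ∈ F ∙ w := by
  have key : ∀ i i' k, (lineMatrix a w *ᵥ x) ((i, i'), k) =
      w i * tensorForm a x (Pi.single k 1) i' - w i' * tensorForm a x (Pi.single k 1) i := by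
    intro i i' k
    rw [tensorForm_single, tensorForm_single]
    simp only [lineMatrix, mulVec, dotProduct, of_apply, Finset.mul_sum, sub_mul,
      Finset.sum_sub_distrib, mul_assoc]
  constructor
  · intro h y
    have h1 : ∀ k, tensorForm a x (Pi.single k 1) ∈ F ∙ w := by
      intro k
      rw [mem_span_singleton_iff_forall hw]
      intro i i'
      rw [← key, h]
      rfl
    rw [← Finset.univ_sum_single y, map_sum]
    refine Submodule.sum_mem _ fun k _ => ?_
    have : (Pi.single k (y k) : Fin n → F) = y k • Pi.single k 1 := by
      rw [← Pi.single_smul, smul_eq_mul, mul_one]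
    rw [this, map_smul]
    exact Submodule.smul_mem _ _ (h1 k)
  · intro h
    ext ⟨⟨i, i'⟩, k⟩
    rw [key]
    exact (mem_span_singleton_iff_forall hw).1 (h _) i i'

end Tensor

section Descent

open Matrix

variable {m n : ℕ}

/-- A nonzero vector over `K(t)` is proportional to a polynomial vector that does not vanish
at `t = 0`. -/
theorem exists_polynomial_vector {K : Type*} [Field K] (w : Fin m → FractionRing (Polynomial K))
    (hw : w ≠ 0) : ∃ (q : Fin m → Polynomial K) (c : FractionRing (Polynomial K)),
      (∀ i, w i = c * algebraMap _ _ (q i)) ∧ ∃ i, (q i).coeff 0 ≠ 0 := by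
  classical
  obtain ⟨b, hb⟩ := IsLocalization.exist_integer_multiples_of_finite
    (nonZeroDivisors (Polynomial K)) w
  choose p hp using hb
  have hb0 : algebraMap (Polynomial K) (FractionRing (Polynomial K)) b ≠ 0 :=
    IsLocalization.to_map_ne_zero_of_mem_nonZeroDivisors _ le_rfl b.2
  have hp' : ∀ i, algebraMap _ (FractionRing (Polynomial K)) (p i) =
      algebraMap _ _ (b : Polynomial K) * w i := by
    intro i
    rw [hp i, Algebra.smul_def]
  obtain ⟨i₁, hi₁⟩ := Function.ne_iff.1 hw
  have hne : (Finset.univ.filter fun i => p i ≠ 0).Nonempty := by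
    refine ⟨i₁, Finset.mem_filter.2 ⟨Finset.mem_univ _, fun h => ?_⟩⟩
    have := hp' i₁
    rw [h, map_zero] at this
    exact mul_ne_zero hb0 hi₁ this.symm
  obtain ⟨i₀, hi₀, hmin⟩ := Finset.exists_min_image _ (fun i => (p i).natTrailingDegree) hne
  have hi₀ := (Finset.mem_filter.1 hi₀).2
  have hcoeff := Polynomial.coeff_natTrailingDegree_ne_zero.2 hi₀
  generalize (p i₀).natTrailingDegree = e at hmin hcoeff
  have hdvd : ∀ i, Polynomial.X ^ e ∣ p i := by
    intro i
    rw [Polynomial.X_pow_dvd_iff]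
    intro d hd
    by_cases hpi : p i = 0
    · simp [hpi]
    · exact Polynomial.coeff_eq_zero_of_lt_natTrailingDegree
        (hd.trans_le (hmin i (Finset.mem_filter.2 ⟨Finset.mem_univ _, hpi⟩)))
  choose q hq using hdvd
  refine ⟨q, (algebraMap _ _ (b : Polynomial K))⁻¹ *
    algebraMap _ _ (Polynomial.X ^ e : Polynomial K), fun i => ?_, i₀, fun h0 => ?_⟩
  · rw [mul_assoc, ← map_mul, ← hq, hp', inv_mul_cancel_left₀ hb0]
  · have h1 := Polynomial.coeff_X_pow_mul (q i₀) e 0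
    rw [← hq i₀, zero_add, h0] at h1
    exact hcoeff h1

variable {K : Type*} [Field K]

theorem exists_radical_iff (a : Fin m → Fin n → Fin n → K) (k : ℕ) :
    (∃ X : Submodule K (Fin n → K), finrank K (Fin n → K) ≤ finrank K X + k ∧
      ∀ x ∈ X, ∀ y, tensorForm a x y = 0) ↔ (radicalMatrix a).rank ≤ k := by
  rw [← exists_codim_iff_rank_le]
  simp_rw [radicalMatrix_mulVec_eq_zero_iff]

theorem exists_radical_mod_line_iff (a : Fin m → Fin n → Fin n → K) {w : Fin m → K} (hw : w ≠ 0)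
    (k : ℕ) : (∃ X : Submodule K (Fin n → K), finrank K (Fin n → K) ≤ finrank K X + k ∧
      ∀ x ∈ X, ∀ y, tensorForm a x y ∈ K ∙ w) ↔ (lineMatrix a w).rank ≤ k := by
  rw [← exists_codim_iff_rank_le]
  simp_rw [lineMatrix_mulVec_eq_zero_iff hw]

theorem lineMatrix_map {R S : Type*} [CommRing R] [CommRing S] (f : R →+* S)
    (a : Fin m → Fin n → Fin n → R) (w : Fin m → R) :
    (lineMatrix a w).map f = lineMatrix (fun i j k => f (a i j k)) fun i => f (w i) := by
  ext
  simp [lineMatrix]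

theorem lineMatrix_smul {R : Type*} [CommRing R] (a : Fin m → Fin n → Fin n → R) (c : R)
    (w : Fin m → R) : lineMatrix a (fun i => c * w i) = c • lineMatrix a w := by
  ext
  simp [lineMatrix]
  ring

theorem exists_lineMatrix_rank_le (a : Fin m → Fin n → Fin n → K)
    {w : Fin m → FractionRing (Polynomial K)} (hw : w ≠ 0) :
    ∃ w' : Fin m → K, w' ≠ 0 ∧ (lineMatrix a w').rank ≤
      (lineMatrix (fun i j k => algebraMap K (FractionRing (Polynomial K)) (a i j k)) w).rank := by
  obtain ⟨q, c, hq, i, hi⟩ := exists_polynomial_vector w hw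
  refine ⟨fun i => (q i).coeff 0, fun h => hi (congrFun h i), ?_⟩
  have h1 := rank_map_le_rank_map (lineMatrix (fun i j k => Polynomial.C (a i j k)) q)
    Polynomial.constantCoeff (algebraMap _ (FractionRing (Polynomial K)))
    (IsFractionRing.injective _ _)
  rw [lineMatrix_map, lineMatrix_map] at h1
  simp only [Polynomial.constantCoeff_apply, Polynomial.coeff_C_zero] at h1
  refine h1.trans (le_of_eq ?_)
  have hc : c ≠ 0 := by
    rintro rfl
    exact hw (funext fun i => by simp [hq])
  rw [show w = fun i => c * algebraMap _ _ (q i) from funext hq, lineMatrix_smul,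
    Matrix.rank_smul_of_mem_nonZeroDivisors _ (mem_nonZeroDivisors_of_ne_zero hc)]
  rfl

/-- Classification of polar forms, given by their coefficients, of rank `r ≤ 4` at the generic
point, over an arbitrary field. -/
theorem tensorForm_classification {a : Fin m → Fin n → Fin n → K}
    (hs : ∀ i j k, a i j k = a i k j) (ha : (2 : K) = 0 → ∀ i j, a i j j = 0) {r : ℕ}
    (hr4 : r ≤ 4)
    (hr : ((Matrix.of fun i j => ∑ k, MvPolynomial.C (a i j k) * MvPolynomial.X k).map
      (algebraMap (MvPolynomial (Fin n) K) (FractionRing (MvPolynomial (Fin n) K)))).rank = r) :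
    finrank K (valueSpan (tensorForm a)) ≤ (r + 1).choose 2 ∧
    (finrank K (valueSpan (tensorForm a)) ≤ r + 1 ∨
    (r = 4 ∧ ∃ w : Fin m → K, w ≠ 0 ∧ ∃ k, (k = 3 ∨ ((2 : K) = 0 ∧ k = 4)) ∧
      ∃ X : Submodule K (Fin n → K), finrank K (Fin n → K) ≤ finrank K X + k ∧
      ∀ x ∈ X, ∀ y, tensorForm a x y ∈ K ∙ w) ∨
    (∃ X : Submodule K (Fin n → K), finrank K (Fin n → K) ≤ finrank K X + (r + 1) ∧
      ∀ x ∈ X, ∀ y, tensorForm a x y = 0) ∨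
    (r = 4 ∧ (2 : K) = 0 ∧ finrank K (valueSpan (tensorForm a)) ≤ 6 ∧
      ∃ X : Submodule K (Fin n → K), finrank K (Fin n → K) ≤ finrank K X + 6 ∧
      ∀ x ∈ X, ∀ y, tensorForm a x y = 0)) := by
  let L := FractionRing (Polynomial K)
  let f : K →+* L := algebraMap K L
  have hinj : Function.Injective (algebraMap (Polynomial K) L) := IsFractionRing.injective _ _
  have : Infinite L := Infinite.of_injective _ hinj
  let b : Fin m → Fin n → Fin n → L := fun i j k => f (a i j k)
  have h2 : (2 : L) = 0 ↔ (2 : K) = 0 := by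
    rw [← map_ofNat f 2, map_eq_zero]
  have hB : IsPolar (tensorForm b) :=
    isPolar_tensorForm (fun i j k => by simp only [b, hs i j k])
      (fun h i j => by simp only [b, ha (h2.1 h), map_zero])
  set A : Matrix (Fin m) (Fin n) (MvPolynomial (Fin n) K) :=
    Matrix.of fun i j => ∑ k, MvPolynomial.C (a i j k) * MvPolynomial.X k with hA
  have hAx : ∀ x : Fin n → L, finrank L (LinearMap.range (tensorForm b x)) =
      (A.map (MvPolynomial.eval₂Hom f x)).rank := by
    intro x
    rw [tensorForm_eq_mulVecLin, ← Matrix.rank]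
    congr 1
    ext i j
    simp [hA, b]
  have hle : ∀ x, finrank L (LinearMap.range (tensorForm b x)) ≤ r := by
    intro x
    rw [hAx, ← hr]
    exact rank_map_le_rank_map _ _ _ (IsFractionRing.injective _ _)
  obtain ⟨v, hv⟩ := exists_rank_le_rank_eval f A
  rw [hr, ← hAx] at hv
  have hspan : finrank L (valueSpan (tensorForm b)) = finrank K (valueSpan (tensorForm a)) := by
    rw [finrank_valueSpan_tensorForm, finrank_valueSpan_tensorForm,
      ← rank_map_ringHom_eq (valueMatrix a) f]
    rfl
  have hrad : (radicalMatrix b).rank = (radicalMatrix a).rank := by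
    rw [← rank_map_ringHom_eq (radicalMatrix a) f]
    rfl
  have hradk : ∀ k, (∃ X : Submodule L (Fin n → L), finrank L (Fin n → L) ≤ finrank L X + k ∧
      ∀ x ∈ X, ∀ y, tensorForm b x y = 0) → ∃ X : Submodule K (Fin n → K),
      finrank K (Fin n → K) ≤ finrank K X + k ∧ ∀ x ∈ X, ∀ y, tensorForm a x y = 0 := by
    intro k
    rw [exists_radical_iff, exists_radical_iff, hrad]
    exact id
  rw [← hspan]
  refine ⟨hB.finrank_valueSpan_le hle, ?_⟩
  rcases hB.classification hr4 hle (le_antisymm (hle v) hv) with h | ⟨h4, w, hw, X, hX, hX0⟩ | h |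
    ⟨h4, h0, h6, hX⟩
  · exact Or.inl h
  · right; left
    obtain ⟨w', hw', hle'⟩ := exists_lineMatrix_rank_le a hw
    obtain ⟨k, hk, hXk⟩ : ∃ k, (k = 3 ∨ ((2 : K) = 0 ∧ k = 4)) ∧
        finrank L (Fin n → L) ≤ finrank L X + k := by
      rcases hX with hX | ⟨h0, hX⟩
      · exact ⟨3, Or.inl rfl, hX⟩
      · exact ⟨4, Or.inr ⟨h2.1 h0, rfl⟩, hX⟩
    refine ⟨h4, w', hw', k, hk, ?_⟩
    rw [exists_radical_mod_line_iff a hw']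
    exact hle'.trans ((exists_radical_mod_line_iff b hw k).1 ⟨X, hXk, hX0⟩)
  · exact Or.inr (Or.inr (Or.inl (hradk _ h)))
  · exact Or.inr (Or.inr (Or.inr ⟨h4, h2.1 h0, h6, hradk _ hX⟩))

end Descent

section AdaptedBases

open Matrix

variable {K V : Type*} [Field K] [AddCommGroup V] [Module K V] [FiniteDimensional K V]

theorem exists_basis_extending {P : Submodule K V} {p m : ℕ} (bP : Basis (Fin p) K P)
    (hm : finrank K V = m) :
    ∃ b : Basis (Fin m) K V, ∀ (i : Fin p) (j : Fin m), i.val = j.val → b j = bP i := by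
  obtain ⟨C, hC⟩ := P.exists_isCompl
  have hdim := Submodule.finrank_add_eq_of_isCompl hC
  rw [finrank_eq_card_basis bP, Fintype.card_fin, hm] at hdim
  refine ⟨((bP.prod (finBasis K C)).map (Submodule.prodEquivOfIsCompl P C hC)).reindex
    (finSumFinEquiv.trans (finCongr hdim)), fun i j hij => ?_⟩
  have : (finSumFinEquiv.trans (finCongr hdim)).symm j = Sum.inl i := by
    rw [Equiv.symm_apply_eq]
    ext
    simp [hij]
  rw [Basis.reindex_apply, this]
  simp

omit [FiniteDimensional K V] in
theorem repr_eq_zero_of_mem {P : Submodule K V} {p m : ℕ} (bP : Basis (Fin p) K P)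
    (b : Basis (Fin m) K V) (hpm : p ≤ m)
    (hb : ∀ (i : Fin p) (j : Fin m), i.val = j.val → b j = bP i)
    {z : V} (hz : z ∈ P) {i : Fin m} (hi : p ≤ i.val) : b.repr z i = 0 := by
  have h1 : z = ∑ j, bP.repr ⟨z, hz⟩ j • b (Fin.castLE hpm j) := by
    have h2 := congrArg Subtype.val (bP.sum_repr ⟨z, hz⟩)
    simp only [AddSubmonoidClass.coe_finsetSum, Submodule.coe_smul] at h2
    conv_lhs => rw [← h2]
    exact Finset.sum_congr rfl fun j _ => by rw [hb j _ rfl]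
  rw [h1, map_sum, Finsupp.finsetSum_apply]
  refine Finset.sum_eq_zero fun j _ => ?_
  rw [map_smul, Basis.repr_self, Finsupp.smul_apply, Finsupp.single_apply, if_neg, smul_zero]
  intro h
  have := congrArg Fin.val h
  simp only [Fin.val_castLE] at this
  omega

theorem exists_basis_adapted_flag {P₁ P₂ : Submodule K V} (h : P₁ ≤ P₂) {m : ℕ}
    (hm : finrank K V = m) :
    ∃ b : Basis (Fin m) K V,
      (∀ z ∈ P₁, ∀ i : Fin m, finrank K P₁ ≤ i.val → b.repr z i = 0) ∧
      (∀ z ∈ P₂, ∀ i : Fin m, finrank K P₂ ≤ i.val → b.repr z i = 0) := by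
  let e := (Submodule.comapSubtypeEquivOfLe h).symm
  obtain ⟨b₂, hb₂⟩ := exists_basis_extending ((finBasis K P₁).map e) (rfl : finrank K P₂ = _)
  obtain ⟨b, hb⟩ := exists_basis_extending b₂ hm
  have hle : finrank K P₂ ≤ m := hm ▸ Submodule.finrank_le P₂
  refine ⟨b, fun z hz i hi => ?_, fun z hz i hi => repr_eq_zero_of_mem b₂ b hle hb hz hi⟩
  have hle₁ := Submodule.finrank_mono h
  refine repr_eq_zero_of_mem (finBasis K P₁) b (hle₁.trans hle) (fun i j hij => ?_) hz hi
  rw [hb (Fin.castLE hle₁ i) j hij, hb₂ i _ rfl, Basis.map_apply]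
  rfl

/-- The invertible matrix of a linear automorphism of `K^n`. -/
def glOfLinearEquiv {n : ℕ} (e : (Fin n → K) ≃ₗ[K] (Fin n → K)) :
    Matrix.GeneralLinearGroup (Fin n) K where
  val := LinearMap.toMatrix' e.toLinearMap
  inv := LinearMap.toMatrix' e.symm.toLinearMap
  val_inv := by rw [← LinearMap.toMatrix'_comp]; simp
  inv_val := by rw [← LinearMap.toMatrix'_comp]; simp

theorem glOfLinearEquiv_mulVec {n : ℕ} (e : (Fin n → K) ≃ₗ[K] (Fin n → K)) (x : Fin n → K) :
    (glOfLinearEquiv e).val *ᵥ x = e x :=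
  LinearMap.toMatrix'_mulVec _ _

theorem exists_gl_mulVec_eq_zero {m : ℕ} {P₁ P₂ : Submodule K (Fin m → K)} (h : P₁ ≤ P₂) :
    ∃ S : Matrix.GeneralLinearGroup (Fin m) K,
      (∀ z ∈ P₁, ∀ i : Fin m, finrank K P₁ ≤ i.val → (S.val *ᵥ z) i = 0) ∧
      (∀ z ∈ P₂, ∀ i : Fin m, finrank K P₂ ≤ i.val → (S.val *ᵥ z) i = 0) := by
  obtain ⟨b, h₁, h₂⟩ := exists_basis_adapted_flag h (finrank_fin_fun K (n := m))
  refine ⟨glOfLinearEquiv b.equivFun, fun z hz i hi => ?_, fun z hz i hi => ?_⟩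
  · rw [glOfLinearEquiv_mulVec]
    exact h₁ z hz i hi
  · rw [glOfLinearEquiv_mulVec]
    exact h₂ z hz i hi

theorem exists_gl_mulVec_single_mem {n k : ℕ} {X : Submodule K (Fin n → K)}
    (hX : finrank K (Fin n → K) ≤ finrank K X + k) :
    ∃ T : Matrix.GeneralLinearGroup (Fin n) K,
      ∀ j : Fin n, k ≤ j.val → T.val *ᵥ Pi.single j 1 ∈ X := by
  obtain ⟨b, hb⟩ := exists_basis_extending (finBasis K X) (finrank_fin_fun K (n := n))
  rw [finrank_fin_fun] at hX
  refine ⟨glOfLinearEquiv (b.reindex Fin.revPerm).equivFun.symm, fun j hj => ?_⟩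
  rw [glOfLinearEquiv_mulVec]
  have h1 : (b.reindex Fin.revPerm).equivFun.symm (Pi.single j 1) = b (Fin.rev j) := by
    simp [Basis.equivFun_symm_apply, Pi.single_apply]
  rw [h1, hb ⟨(Fin.rev j).val, by rw [Fin.val_rev]; omega⟩ _ rfl]
  exact Submodule.coe_mem _

end AdaptedBases

section Polynomials

open MvPolynomial

variable {K : Type*} [Field K] {m n : ℕ}

/-- The coefficients of the second order partial derivatives. -/
noncomputable def hessianCoeff (H : Fin m → MvPolynomial (Fin n) K) (i : Fin m) (j k : Fin n) : K :=
  coeff 0 (pderiv k (pderiv j (H i)))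

theorem hessianCoeff_symm (H : Fin m → MvPolynomial (Fin n) K) (i : Fin m) (j k : Fin n) :
    hessianCoeff H i j k = hessianCoeff H i k j := by
  by_cases h : j = k
  · rw [h]
  · simp [hessianCoeff, coeff_pderiv, h, Ne.symm h, add_comm]

theorem hessianCoeff_self (H : Fin m → MvPolynomial (Fin n) K) (h2 : (2 : K) = 0) (i : Fin m)
    (j : Fin n) : hessianCoeff H i j j = 0 := by
  simp [hessianCoeff, coeff_pderiv, one_add_one_eq_two, h2]

theorem pderiv_eq_sum_hessianCoeff {H : Fin m → MvPolynomial (Fin n) K}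
    (hH : ∀ i, (H i).IsHomogeneous 2) (i : Fin m) (j : Fin n) :
    pderiv j (H i) = ∑ k, C (hessianCoeff H i j k) * X k := by
  have h1 : (pderiv j (H i)).IsHomogeneous 1 := (hH i).pderiv
  have h2 := h1.sum_X_mul_pderiv
  rw [one_smul] at h2
  rw [← h2]
  refine Finset.sum_congr rfl fun k _ => ?_
  have h3 : (pderiv k (pderiv j (H i))).IsHomogeneous 0 := h1.pderiv
  rw [mul_comm, hessianCoeff]
  congr 1
  exact (totalDegree_eq_zero_iff_eq_C.1 ((totalDegree_zero_iff_isHomogeneous _).2 h3))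

theorem pderiv_aeval_eq_sum (g : Fin n → MvPolynomial (Fin n) K) (j : Fin n)
    (p : MvPolynomial (Fin n) K) :
    pderiv j (aeval g p) = ∑ l, aeval g (pderiv l p) * pderiv j (g l) := by
  induction p using MvPolynomial.induction_on with
  | C c => simp
  | add p q hp hq => simp only [map_add, hp, hq, add_mul, Finset.sum_add_distrib]
  | mul_X p i hp =>
    rw [map_mul, pderiv_mul, hp, aeval_X]
    simp only [pderiv_mul, map_add, map_mul, aeval_X, add_mul, Finset.sum_add_distrib,
      Finset.sum_mul]
    congr 1
    · exact Finset.sum_congr rfl fun l _ => by ring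
    · rw [Finset.sum_eq_single i]
      · simp
      · intro l _ hl
        simp [pderiv_X_of_ne hl.symm]
      · simp

theorem sum_C_mul_sum_C_mul_X {ι : Type*} [Fintype ι] (c : ι → K) (d : ι → Fin n → K) :
    ∑ t, C (c t) * ∑ s, C (d t s) * X s =
      (∑ s, C (∑ t, c t * d t s) * X s : MvPolynomial (Fin n) K) := by
  simp only [Finset.mul_sum, map_sum, map_mul, Finset.sum_mul]
  rw [Finset.sum_comm]
  simp only [mul_assoc]

open Matrix in
theorem pderiv_linComp {H : Fin m → MvPolynomial (Fin n) K} (hH : ∀ i, (H i).IsHomogeneous 2)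
    (S : Matrix (Fin m) (Fin m) K) (T : Matrix (Fin n) (Fin n) K) (i : Fin m) (j : Fin n) :
    pderiv j (QuadMap.linComp S H T i) = ∑ s, C ((S *ᵥ tensorForm (hessianCoeff H)
      (T *ᵥ Pi.single s 1) (T *ᵥ Pi.single j 1)) i) * X s := by
  have hT : ∀ l, pderiv j (∑ s, C (T l s) * X s : MvPolynomial (Fin n) K) = C (T l j) := by
    intro l
    simp [pderiv_X, Pi.single_apply]
  have key : ∀ k, pderiv j (C (S i k) * aeval (fun l => ∑ s, C (T l s) * X s) (H k)) =
      C (S i k) * ∑ s, C (tensorForm (hessianCoeff H) (T *ᵥ Pi.single s 1)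
        (T *ᵥ Pi.single j 1) k) * X s := by
    intro k
    have h1 : ∀ l, aeval (fun l => ∑ s, C (T l s) * X s) (pderiv l (H k)) *
        pderiv j (∑ s, C (T l s) * X s : MvPolynomial (Fin n) K) =
        C (T l j) * ∑ s, C (∑ t, hessianCoeff H k l t * T t s) * X s := by
      intro l
      rw [hT, pderiv_eq_sum_hessianCoeff hH, map_sum, mul_comm,
        ← sum_C_mul_sum_C_mul_X (fun t => hessianCoeff H k l t) (fun t s => T t s)]
      simp only [map_mul, algHom_C, algebraMap_eq, aeval_X]
    rw [pderiv_C_mul, pderiv_aeval_eq_sum]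
    simp_rw [h1]
    rw [sum_C_mul_sum_C_mul_X]
    simp [tensorForm_apply, mul_comm (T _ j)]
  rw [QuadMap.linComp, map_sum]
  simp_rw [key]
  rw [sum_C_mul_sum_C_mul_X]
  rfl

theorem isHomogeneous_linComp {H : Fin m → MvPolynomial (Fin n) K}
    (hH : ∀ i, (H i).IsHomogeneous 2)
    (S : Matrix (Fin m) (Fin m) K) (T : Matrix (Fin n) (Fin n) K) (i : Fin m) :
    (QuadMap.linComp S H T i).IsHomogeneous 2 := by
  refine IsHomogeneous.sum _ _ _ fun k _ => ?_
  rw [← zero_add 2]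
  refine (isHomogeneous_C _ _).mul ?_
  have h1 := (hH k).aeval (fun j : Fin n => (∑ l, C (T j l) * X l : MvPolynomial (Fin n) K))
    (n := 1) fun j => IsHomogeneous.sum _ _ _ fun l _ => by
      simpa using (isHomogeneous_C (Fin n) (T j l)).mul (isHomogeneous_X K l)
  simpa using h1

theorem cast_eq_zero_of_pderiv_eq_zero {p : MvPolynomial (Fin n) K} {j : Fin n}
    (hp : pderiv j p = 0) {s : Fin n →₀ ℕ} (hs : s ∈ p.support) : ((s j : ℕ) : K) = 0 := by
  by_cases h0 : s j = 0
  · simp [h0]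
  have h1 := coeff_pderiv (i := j) p (s - Finsupp.single j 1 : Fin n →₀ ℕ)
  have h2 : s - Finsupp.single j 1 + Finsupp.single j 1 = s :=
    tsub_add_cancel_of_le (Finsupp.single_le_iff.2 (Nat.one_le_iff_ne_zero.2 h0))
  rw [hp, coeff_zero, h2] at h1
  have h3 : (((s - Finsupp.single j 1 : Fin n →₀ ℕ) j : ℕ) : K) + 1 = (s j : K) := by
    rw [← Nat.cast_succ]
    congr 1
    simp
    omega
  rw [h3] at h1
  exact (mul_eq_zero.1 h1.symm).resolve_left (mem_support_iff.1 hs)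

theorem le_two_of_mem_support {p : MvPolynomial (Fin n) K} (hp : p.IsHomogeneous 2)
    {s : Fin n →₀ ℕ} (hs : s ∈ p.support) (j : Fin n) : s j ≤ 2 := by
  have h1 := hp (mem_support_iff.1 hs)
  exact (Finsupp.le_degree j s).trans_eq
    ((DFunLike.congr_fun (Finsupp.degree_eq_weight_one (R := ℕ)) s).trans h1)

theorem mem_supported_of_pderiv_eq_zero {p : MvPolynomial (Fin n) K} (hp : p.IsHomogeneous 2)
    (h2 : (2 : K) ≠ 0) {d : ℕ} (hd : ∀ j : Fin n, d ≤ j.val → pderiv j p = 0) :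
    p ∈ supported K {j : Fin n | j.val < d} := by
  rw [mem_supported]
  intro j hj
  obtain ⟨s, hs, hj⟩ := (mem_vars_iff_mem_support j).1 hj
  by_contra hjd
  have h1 := cast_eq_zero_of_pderiv_eq_zero (hd j (not_lt.1 hjd)) hs
  have h3 := le_two_of_mem_support hp hs j
  have h4 := Finsupp.mem_support_iff.1 hj
  obtain h | h : s j = 1 ∨ s j = 2 := by omega
  · simp [h] at h1
  · rw [h] at h1
    exact h2 (by exact_mod_cast h1)

theorem mem_varsThenSquares_of_pderiv_eq_zero {p : MvPolynomial (Fin n) K}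
    (hp : p.IsHomogeneous 2) {d : ℕ} (hd : ∀ j : Fin n, d ≤ j.val → pderiv j p = 0) :
    p ∈ QuadMap.varsThenSquares K n d := by
  rw [p.as_sum]
  refine Subalgebra.sum_mem _ fun s hs => ?_
  rw [monomial_eq, Finsupp.prod_fintype _ _ (by simp)]
  refine Subalgebra.mul_mem _ (Subalgebra.algebraMap_mem _ _) (Subalgebra.prod_mem _ fun j _ => ?_)
  by_cases hj : j.val < d
  · exact Subalgebra.pow_mem _ (Algebra.subset_adjoin (Set.mem_union_left _ (Set.mem_ofPred.2 ⟨j, hj, rfl⟩))) _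
  · have h1 := cast_eq_zero_of_pderiv_eq_zero (hd j (not_lt.1 hj)) hs
    have h3 := le_two_of_mem_support hp hs j
    obtain h | h | h : s j = 0 ∨ s j = 1 ∨ s j = 2 := by omega
    · rw [h, pow_zero]
      exact Subalgebra.one_mem _
    · simp [h] at h1
    · rw [h]
      exact Algebra.subset_adjoin (Set.mem_union_right _ (Set.mem_ofPred.2 ⟨j, not_lt.1 hj, rfl⟩))

theorem ringChar_eq_two_iff : ringChar K = 2 ↔ (2 : K) = 0 := by
  have h := ringChar.spec K 2
  rw [Nat.cast_ofNat] at h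
  rw [h]
  constructor
  · intro h; rw [h]
  · intro h
    exact ((Nat.dvd_prime Nat.prime_two).1 h).resolve_left (CharP.ringChar_ne_one)

end Polynomials

section MainTheorem

open MvPolynomial Matrix

variable {K : Type*} [Field K] {m n : ℕ} {H : Fin m → MvPolynomial (Fin n) K}

theorem jacobian_linComp_eq_zero (hH : ∀ i, (H i).IsHomogeneous 2)
    {S : Matrix (Fin m) (Fin m) K} {T : Matrix (Fin n) (Fin n) K} {i : Fin m} {j : Fin n}
    (h : ∀ x, (S *ᵥ tensorForm (hessianCoeff H) x (T *ᵥ Pi.single j 1)) i = 0) :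
    QuadMap.jacobian (QuadMap.linComp S H T) i j = 0 := by
  rw [QuadMap.jacobian, of_apply, pderiv_linComp hH]
  exact Finset.sum_eq_zero fun s _ => by rw [h, C_0, zero_mul]

theorem onlyFirstRows_jacobian_linComp (hH : ∀ i, (H i).IsHomogeneous 2)
    {S : Matrix (Fin m) (Fin m) K} (T : Matrix (Fin n) (Fin n) K) {d k : ℕ} (hdk : d ≤ k)
    (hS : ∀ z ∈ valueSpan (tensorForm (hessianCoeff H)), ∀ i : Fin m, d ≤ i.val →
      (S *ᵥ z) i = 0) :
    QuadMap.OnlyFirstRows (QuadMap.jacobian (QuadMap.linComp S H T)) k :=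
  fun i _ hi => jacobian_linComp_eq_zero hH fun _ =>
    hS _ (apply_mem_valueSpan _ _ _) i (hdk.trans hi)

theorem onlyFirstCols_jacobian_linComp (hH : ∀ i, (H i).IsHomogeneous 2)
    (S : Matrix (Fin m) (Fin m) K) {T : Matrix (Fin n) (Fin n) K} {k : ℕ}
    {X : Submodule K (Fin n → K)} (hX : ∀ x ∈ X, ∀ y, tensorForm (hessianCoeff H) x y = 0)
    (hT : ∀ j : Fin n, k ≤ j.val → T *ᵥ Pi.single j 1 ∈ X)
    (hB : IsPolar (tensorForm (hessianCoeff H))) :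
    QuadMap.OnlyFirstCols (QuadMap.jacobian (QuadMap.linComp S H T)) k :=
  fun i j hj => jacobian_linComp_eq_zero hH fun x => by
    rw [hB.symm, hX _ (hT j hj), mulVec_zero, Pi.zero_apply]

end MainTheorem

theorem mainTheorem3 {K : Type*} [Field K] {m n : ℕ} (H : Fin m → MvPolynomial (Fin n) K)
    (hH : ∀ i, (H i).IsHomogeneous 2) (r : ℕ) (hr : QuadMap.jacobianRank H = r) (hr4 : r ≤ 4) :
    ∃ (S : Matrix.GeneralLinearGroup (Fin m) K) (T : Matrix.GeneralLinearGroup (Fin n) K)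
      (G : Fin m → MvPolynomial (Fin n) K),
      G = QuadMap.linComp S.val H T.val ∧
      QuadMap.OnlyFirstRows (QuadMap.jacobian G) ((r ^ 2 + r) / 2) ∧
      (QuadMap.OnlyFirstRows (QuadMap.jacobian G) (r + 1) ∨
       (r = 4 ∧ (∀ i : Fin m, 1 ≤ i.val → G i ∈ MvPolynomial.supported K {j : Fin n | j.val < 3}) ∧
          ringChar K ≠ 2) ∨
       (r = 4 ∧ (∀ i : Fin m, 1 ≤ i.val → G i ∈ QuadMap.varsThenSquares K n 4) ∧
          ringChar K = 2) ∨
       QuadMap.OnlyFirstCols (QuadMap.jacobian G) (r + 1) ∨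
       (r = 4 ∧ QuadMap.OnlyFirstRows (QuadMap.jacobian G) 6 ∧
          QuadMap.OnlyFirstCols (QuadMap.jacobian G) 6 ∧ ringChar K = 2)) := by
  have hs : ∀ i j k, hessianCoeff H i j k = hessianCoeff H i k j := hessianCoeff_symm H
  have ha : (2 : K) = 0 → ∀ i j, hessianCoeff H i j j = 0 := hessianCoeff_self H
  have hB := isPolar_tensorForm hs ha
  have hJ : QuadMap.jacobian H =
      Matrix.of fun i j => ∑ k, MvPolynomial.C (hessianCoeff H i j k) * MvPolynomial.X k := by
    ext1 i j
    exact pderiv_eq_sum_hessianCoeff hH i j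
  rw [QuadMap.jacobianRank, hJ] at hr
  obtain ⟨hbound, hcases⟩ := tensorForm_classification hs ha hr4 hr
  have hchoose : (r + 1).choose 2 = (r ^ 2 + r) / 2 := by
    rw [Nat.choose_two_right, Nat.add_sub_cancel]
    congr 1
    ring
  rw [hchoose] at hbound
  obtain ⟨S₀, -, hS₀⟩ := exists_gl_mulVec_eq_zero
    (le_refl (valueSpan (tensorForm (hessianCoeff H))))
  have hrows := fun T => onlyFirstRows_jacobian_linComp hH T hbound hS₀
  have hcols : ∀ X : Submodule K (Fin n → K), finrank K (Fin n → K) ≤ finrank K X + (r + 1) →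
      (∀ x ∈ X, ∀ y, tensorForm (hessianCoeff H) x y = 0) →
      ∃ T : Matrix.GeneralLinearGroup (Fin n) K, QuadMap.OnlyFirstCols
        (QuadMap.jacobian (QuadMap.linComp S₀.val H T.val)) (r + 1) := by
    intro X hX hX0
    obtain ⟨T, hT⟩ := exists_gl_mulVec_single_mem hX
    exact ⟨T, onlyFirstCols_jacobian_linComp hH _ hX0 hT hB⟩
  rcases hcases with h1 | ⟨rfl, w, hw, k, hk, X, hX, hX0⟩ | ⟨X, hX, hX0⟩ | ⟨rfl, h2, h6, X, hX, hX0⟩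
  · exact ⟨S₀, 1, _, rfl, hrows _, Or.inl (onlyFirstRows_jacobian_linComp hH _ h1 hS₀)⟩
  · by_cases hwS : w ∈ valueSpan (tensorForm (hessianCoeff H))
    · obtain ⟨S, hS₁, hS₂⟩ := exists_gl_mulVec_eq_zero
        ((Submodule.span_singleton_le_iff_mem w _).2 hwS)
      rw [finrank_span_singleton hw] at hS₁
      obtain ⟨T, hT⟩ := exists_gl_mulVec_single_mem hX
      have hpd : ∀ i : Fin m, 1 ≤ i.val → ∀ j : Fin n, k ≤ j.val →
          MvPolynomial.pderiv j (QuadMap.linComp S.val H T.val i) = 0 := by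
        intro i hi j hj
        refine jacobian_linComp_eq_zero hH fun x => ?_
        rw [hB.symm]
        exact hS₁ _ (hX0 _ (hT j hj) x) i hi
      have hhom := isHomogeneous_linComp hH S.val T.val
      refine ⟨S, T, _, rfl, onlyFirstRows_jacobian_linComp hH _ hbound hS₂, Or.inr ?_⟩
      by_cases h2 : (2 : K) = 0
      · have hk4 : k ≤ 4 := by omega
        exact Or.inr (Or.inl ⟨rfl, fun i hi => mem_varsThenSquares_of_pderiv_eq_zero (hhom i)
          fun j hj => hpd i hi j (hk4.trans hj), ringChar_eq_two_iff.2 h2⟩)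
      · obtain rfl : k = 3 := hk.resolve_right fun h => h2 h.1
        exact Or.inl ⟨rfl, fun i hi => mem_supported_of_pderiv_eq_zero (hhom i) h2 (hpd i hi),
          fun h => h2 (ringChar_eq_two_iff.1 h)⟩
    · obtain ⟨T, hT⟩ := hcols X (by omega) fun x hx y => by
        obtain ⟨c, hc⟩ := Submodule.mem_span_singleton.1 (hX0 x hx y)
        have hmem := apply_mem_valueSpan (tensorForm (hessianCoeff H)) x y
        rw [← hc] at hmem ⊢
        by_contra hne
        exact hwS ((Submodule.smul_mem_iff _ (left_ne_zero_of_smul hne)).1 hmem)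
      exact ⟨S₀, T, _, rfl, hrows _, Or.inr (Or.inr (Or.inr (Or.inl hT)))⟩
  · obtain ⟨T, hT⟩ := hcols X hX hX0
    exact ⟨S₀, T, _, rfl, hrows _, Or.inr (Or.inr (Or.inr (Or.inl hT)))⟩
  · obtain ⟨T, hT⟩ := exists_gl_mulVec_single_mem hX
    exact ⟨S₀, T, _, rfl, hrows _, Or.inr (Or.inr (Or.inr (Or.inr ⟨rfl,
      onlyFirstRows_jacobian_linComp hH _ h6 hS₀, onlyFirstCols_jacobian_linComp hH _ hX0 hT hB,
      ringChar_eq_two_iff.2 h2⟩)))⟩
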